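/- Consider germs at $+\infty$ of real-valued functions (two functions are identified if they agree for all sufficiently large $x$). A \emph{Hardy field} is a subfield of the ring of such germs that is closed under differentiation. Let $a:\mathbb{R}\to\mathbb{R}$ be a function whose germ belongs to some Hardy field. Suppose that $a$ has polynomial growth, i.e. $a(x)/x^k\to 0$ as $x\to\infty$ for some $k\in\mathbb{N}$, and that $$\lim_{x\to\infty}|a(x)-c\,p(x)|=\infty\qquad\text{for every } p\in\mathbb{Z}[x] \text{ and } c\in\mathbb{R}.$$ Write $[t]$ for the integer part (floor) of $t$. Then: (i) The set $S=\{[a(1)],[a(2)],\ldots\}$ is a set of single recurrence: for every probability space $(X,\mathcal{B},\mu)$, every invertible map $T\colon X\to X$ such that $T$ and $T^{-1}$ are measurable and $T$ preserves $\mu$, and every $A\in\mathcal{B}$ with $\mu(A)>0$, there is a non-zero $s\in S$ with $\mu(A\cap T^{-s}A)>0$. (ii) Every set $\Lambda\subset\mathbb{Z}$ with positive upper density $\bar d(\Lambda)=\limsup_{N\to\infty}\frac{|\Lambda\cap\{-N,\ldots,N\}|}{2N+1}>0$ contains $x,y\in\Lambda$ such that $y-x=[a(n)]$ for some integer $n\ge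 1$ with $[a(n)]\neq 0$. -/

import Mathlib

open Filter MeasureTheory

universe u

noncomputable section

namespace HardyRecurrence

/-- A Hardy field: a subring `H` of the ring of germs at `+∞` of real functions which is a field
and which is closed under differentiation. If `f` and `g` agree for all large `x`, then so do
`deriv f` and `deriv g`, so the second clause only concerns the germ of `f`; it also requires
that the elements of `H` are differentiable at all large `x`. -/
structure IsHardyField (H : Subring (Germ (atTop : Filter ℝ) ℝ)) : Prop where
  isField : IsField H
  deriv_mem : ∀ f : ℝ → ℝ, (f : Germ (atTop : Filter ℝ) ℝ) ∈ H →
    (∀ᶠ x in atTop, DifferentiableAt ℝ f x) ∧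
      ((deriv f : ℝ → ℝ) : Germ (atTop : Filter ℝ) ℝ) ∈ H

/-- The germ at `+∞` of `a` belongs to the union of all Hardy fields. -/
def MemHardy (a : ℝ → ℝ) : Prop :=
  ∃ H : Subring (Germ (atTop : Filter ℝ) ℝ), IsHardyField H ∧
    (a : Germ (atTop : Filter ℝ) ℝ) ∈ H

/-- Polynomial growth: `a(x) / x ^ k → 0` for some `k`. -/
def PolynomialGrowth (a : ℝ → ℝ) : Prop :=
  ∃ k : ℕ, Tendsto (fun x : ℝ => a x / x ^ k) atTop (nhds 0)

/-- `S` is a set of single recurrence: for every invertible measure preserving transformation `T`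
of a probability space and every measurable `A` of positive measure, there is a nonzero `s ∈ S`
such that `A ∩ T⁻ˢ A` has positive measure. -/
def IsSetOfSingleRecurrence (S : Set ℤ) : Prop :=
  ∀ (X : Type u) [MeasurableSpace X] (μ : Measure X) [IsProbabilityMeasure μ] (T : X ≃ᵐ X),
    MeasurePreserving T μ μ →
      ∀ A : Set X, MeasurableSet A → 0 < μ A →
        ∃ s ∈ S, s ≠ 0 ∧ 0 < μ (A ∩ ⇑((T.toEquiv : Equiv.Perm X) ^ s) ⁻¹' A)

/-- Upper density `limsup |Λ ∩ {-N, …, N}| / (2 N + 1)` of a set of integers. -/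
def upperDensity (Λ : Set ℤ) : ℝ :=
  limsup (fun N : ℕ => ((Λ ∩ Set.Icc (-(N : ℤ)) (N : ℤ)).ncard : ℝ) / (2 * (N : ℝ) + 1)) atTop

end HardyRecurrence

end

/-! ### Characters and weighted averages. -/

namespace HardyRecurrence

open Finset Topology fwdDiff
open scoped ComplexConjugate

/-! The core is equidistribution: for suitable weights `w`, the averages of `ex (t * a n)` tend to
zero for every real `t ≠ 0` (`exists_weight`). Uniform weights do not always suffice: `log n` is not
equidistributed mod 1 for them.

Differences of `a` of every order have eventually constant sign, since `a` lies in a Hardy field,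
and polynomial growth makes some `Δ^k a` tend to zero. Summing back gives `a = q + b` with `q`
polynomial and either `b → 0`, or `Δ^m b → ±∞` while `Δ^(m+1) b → 0` (`exists_poly_add`). If `b →
0`, being far from every `c * p` forces an irrational nonconstant coefficient in `t * q`, and Weyl's
theorem applies with uniform weights. Otherwise the increments of `g = ±Δ^m b` serve as weights: the
weighted sum of `ex (β * g n)` is a Riemann sum of a bounded integral, and `m` van der Corput steps
reduce `t * a` to this case (`tendsto_ex_add_poly`).

A periodic factor vanishing at the integers carries this over to the integer part (`tendsto_floor`).
The result is a bounded sequence of trigonometric polynomials with frequencies among the nonzero `⌊a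
n⌋`, tending to 1/2 at the trivial character and to 0 elsewhere. Dense finite sets avoiding these
differences would yield, in the limit, a measure on the circle with an atom at 0 but zero Fourier
coefficients at these frequencies, which is impossible (`intersective_of_trigPolynomials`). Both
conclusions follow from this finitary statement by averaging over windows. -/

/-- The character `x ↦ exp (2 π i x)` of `ℝ`. -/
noncomputable def ex (x : ℝ) : ℂ := Complex.exp ((2 * Real.pi * x : ℝ) * Complex.I)

lemma ex_add (x y : ℝ) : ex (x + y) = ex x * ex y := by
  simp only [ex]
  rw [← Complex.exp_add]
  congr 1
  push_cast
  ring

lemma norm_ex (x : ℝ) : ‖ex x‖ = 1 := Complex.norm_exp_ofReal_mul_I _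

lemma ex_zero : ex 0 = 1 := by simp [ex]

lemma conj_ex (x : ℝ) : conj (ex x) = ex (-x) := by
  simp only [ex]
  rw [← Complex.exp_conj, map_mul, Complex.conj_I, Complex.conj_ofReal]
  congr 1
  push_cast
  ring

lemma ex_sub (x y : ℝ) : ex (x - y) = ex x * conj (ex y) := by
  rw [sub_eq_add_neg, ex_add, conj_ex]

lemma ex_int (k : ℤ) : ex k = 1 := by
  rw [ex, Complex.exp_eq_one_iff]
  exact ⟨k, by push_cast; ring⟩

lemma ex_add_int (x : ℝ) (k : ℤ) : ex (x + k) = ex x := by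
  rw [ex_add, ex_int, mul_one]

lemma ex_eq_one_iff (x : ℝ) : ex x = 1 ↔ ∃ k : ℤ, x = k := by
  constructor
  · intro h
    rw [ex, Complex.exp_eq_one_iff] at h
    obtain ⟨k, hk⟩ := h
    refine ⟨k, ?_⟩
    have h2 : ((2 * Real.pi * x : ℝ) : ℂ) = ((2 * Real.pi * k : ℝ) : ℂ) := by
      apply mul_right_cancel₀ Complex.I_ne_zero
      rw [hk]; push_cast; ring
    have h3 := Complex.ofReal_injective h2
    exact mul_left_cancel₀ (by positivity) h3
  · rintro ⟨k, rfl⟩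
    exact ex_int k

lemma continuous_ex : Continuous ex := by
  unfold ex
  fun_prop

lemma mul_conj_ex (x : ℝ) : ex x * conj (ex x) = 1 := by
  rw [← ex_sub, sub_self, ex_zero]

/-- Weights for which the weighted averages are asymptotically shift invariant. -/
structure IsWeight (w : ℕ → ℝ) : Prop where
  nonneg : ∀ n, 0 ≤ w n
  tendsto_sum : Tendsto (fun K ↦ ∑ n ∈ range K, w n) atTop atTop
  variation : ∃ C, ∀ K, ∑ n ∈ range K, |w (n + 1) - w n| ≤ C

/-- The average of `u` over `{0, …, K - 1}` with weights `w`. -/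
noncomputable def wavg (w : ℕ → ℝ) (u : ℕ → ℂ) (K : ℕ) : ℂ :=
  (∑ n ∈ range K, (w n : ℂ) * u n) / ((∑ n ∈ range K, w n : ℝ) : ℂ)

section Averages

variable {w : ℕ → ℝ}

lemma wavg_add (u v : ℕ → ℂ) (K : ℕ) :
    wavg w (fun n ↦ u n + v n) K = wavg w u K + wavg w v K := by
  simp only [wavg, mul_add, sum_add_distrib, add_div]

lemma wavg_sub (u v : ℕ → ℂ) (K : ℕ) :
    wavg w (fun n ↦ u n - v n) K = wavg w u K - wavg w v K := by
  simp only [wavg, mul_sub, sum_sub_distrib, sub_div]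

lemma wavg_const_mul (c : ℂ) (u : ℕ → ℂ) (K : ℕ) :
    wavg w (fun n ↦ c * u n) K = c * wavg w u K := by
  simp only [wavg, mul_left_comm _ c, ← mul_sum, mul_div_assoc]

lemma wavg_sum {ι : Type*} (s : Finset ι) (u : ι → ℕ → ℂ) (K : ℕ) :
    wavg w (fun n ↦ ∑ i ∈ s, u i n) K = ∑ i ∈ s, wavg w (u i) K := by
  simp only [wavg, mul_sum]
  rw [sum_comm, sum_div]

lemma wavg_conj (u : ℕ → ℂ) (K : ℕ) :
    wavg w (fun n ↦ conj (u n)) K = conj (wavg w u K) := by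
  simp [wavg, map_div₀, map_sum]

lemma IsWeight.sum_nonneg (hw : IsWeight w) (K : ℕ) : 0 ≤ ∑ n ∈ range K, w n :=
  Finset.sum_nonneg fun n _ ↦ hw.nonneg n

lemma IsWeight.norm_wavg_le (hw : IsWeight w) {u : ℕ → ℂ} {C : ℝ} (hC : 0 ≤ C)
    (hu : ∀ n, ‖u n‖ ≤ C) (K : ℕ) : ‖wavg w u K‖ ≤ C := by
  rw [wavg, norm_div, Complex.norm_real, Real.norm_of_nonneg (hw.sum_nonneg K)]
  apply div_le_of_le_mul₀ (hw.sum_nonneg K) hC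
  calc ‖∑ n ∈ range K, (w n : ℂ) * u n‖ ≤ ∑ n ∈ range K, ‖(w n : ℂ) * u n‖ := norm_sum_le _ _
    _ ≤ ∑ n ∈ range K, C * w n := by
        apply sum_le_sum
        intro n _
        rw [norm_mul, Complex.norm_real, Real.norm_of_nonneg (hw.nonneg n), mul_comm]
        exact mul_le_mul_of_nonneg_right (hu n) (hw.nonneg n)
    _ = C * ∑ n ∈ range K, w n := by rw [mul_sum]

lemma IsWeight.tendsto_one (hw : IsWeight w) :
    Tendsto (wavg w fun _ ↦ 1) atTop (𝓝 1) := by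
  apply tendsto_const_nhds.congr'
  filter_upwards [hw.tendsto_sum.eventually_gt_atTop 0] with K hK
  rw [wavg]
  simp only [mul_one]
  rw [← Complex.ofReal_sum, div_self]
  exact_mod_cast hK.ne'

lemma IsWeight.tendsto_div (hw : IsWeight w) {F : ℕ → ℂ} {C : ℝ} (hF : ∀ K, ‖F K‖ ≤ C) :
    Tendsto (fun K ↦ F K / ((∑ n ∈ range K, w n : ℝ) : ℂ)) atTop (𝓝 0) := by
  rw [tendsto_zero_iff_norm_tendsto_zero]
  have h1 : Tendsto (fun K ↦ C / ∑ n ∈ range K, w n) atTop (𝓝 0) :=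
    tendsto_const_nhds.div_atTop hw.tendsto_sum
  refine squeeze_zero (fun _ ↦ norm_nonneg _) (fun K ↦ ?_) h1
  rw [norm_div, Complex.norm_real, Real.norm_of_nonneg (hw.sum_nonneg K)]
  exact div_le_div_of_nonneg_right (hF K) (hw.sum_nonneg K)

lemma IsWeight.tendsto_sum_div_of_isLittleO (hw : IsWeight w) {v : ℕ → ℂ}
    (hv : v =o[atTop] w) :
    Tendsto (fun K ↦ (∑ n ∈ range K, v n) / ((∑ n ∈ range K, w n : ℝ) : ℂ)) atTop (𝓝 0) := by
  have h1 := hv.sum_range (fun n ↦ hw.nonneg n) hw.tendsto_sum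
  rw [tendsto_zero_iff_norm_tendsto_zero]
  have := h1.norm_left.tendsto_div_nhds_zero
  refine this.congr fun K ↦ ?_
  rw [norm_div, Complex.norm_real, Real.norm_of_nonneg (hw.sum_nonneg K)]

lemma IsWeight.tendsto_zero (hw : IsWeight w) {v : ℕ → ℂ} (hv : Tendsto v atTop (𝓝 0)) :
    Tendsto (wavg w v) atTop (𝓝 0) := by
  apply hw.tendsto_sum_div_of_isLittleO
  have h1 : (fun n ↦ (w n : ℂ)) =O[atTop] w := by
    apply Asymptotics.IsBigO.of_bound 1
    filter_upwards with n
    simp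
  have := h1.mul_isLittleO ((Asymptotics.isLittleO_one_iff ℝ).2 hv)
  simpa using this

/-- Summation by parts: the difference of the two sums is bounded by boundary terms plus the total
variation of `w`, while the total weight diverges. -/
lemma IsWeight.shift_one (hw : IsWeight w) {u : ℕ → ℂ} (hu : ∀ n, ‖u n‖ ≤ 1) :
    Tendsto (fun K ↦ wavg w (fun n ↦ u (n + 1)) K - wavg w u K) atTop (𝓝 0) := by
  obtain ⟨C, hC⟩ := hw.variation
  have hwb : ∀ K, w K ≤ w 0 + C := by
    intro K
    have h1 : w K - w 0 = ∑ n ∈ range K, (w (n + 1) - w n) := (sum_range_sub w K).symm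
    have h2 : ∑ n ∈ range K, (w (n + 1) - w n) ≤ ∑ n ∈ range K, |w (n + 1) - w n| :=
      sum_le_sum fun n _ ↦ le_abs_self _
    linarith [hC K]
  have key : ∀ K, ∑ n ∈ range K, (w n : ℂ) * u (n + 1) - ∑ n ∈ range K, (w n : ℂ) * u n
      = (w K : ℂ) * u K - w 0 * u 0 - ∑ n ∈ range K, ((w (n + 1) - w n : ℝ) : ℂ) * u (n + 1) := by
    intro K
    rw [← sum_range_sub (fun n ↦ (w n : ℂ) * u n) K, ← sum_sub_distrib, ← sum_sub_distrib]
    apply sum_congr rfl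
    intro n _
    push_cast
    ring
  have hF := hw.tendsto_div (F := fun K ↦ ∑ n ∈ range K, (w n : ℂ) * u (n + 1)
      - ∑ n ∈ range K, (w n : ℂ) * u n) (C := (w 0 + C) + w 0 + C) (by
    intro K
    rw [key]
    have hm : ∀ n m, ‖(w n : ℂ) * u m‖ ≤ w n := by
      intro n m
      rw [norm_mul, Complex.norm_real, Real.norm_of_nonneg (hw.nonneg n)]
      exact mul_le_of_le_one_right (hw.nonneg n) (hu m)
    have h3 : ‖∑ n ∈ range K, ((w (n + 1) - w n : ℝ) : ℂ) * u (n + 1)‖ ≤ C := by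
      refine (norm_sum_le _ _).trans (le_trans (sum_le_sum fun n _ ↦ ?_) (hC K))
      rw [norm_mul, Complex.norm_real, Real.norm_eq_abs]
      exact mul_le_of_le_one_right (abs_nonneg _) (hu _)
    calc _ ≤ ‖(w K : ℂ) * u K - w 0 * u 0‖ + _ := norm_sub_le _ _
      _ ≤ (‖(w K : ℂ) * u K‖ + ‖(w 0 : ℂ) * u 0‖) + _ := by gcongr; exact norm_sub_le _ _
      _ ≤ _ := by
        gcongr
        · exact (hm _ _).trans (hwb K)
        · exact hm _ _)
  refine hF.congr fun K ↦ ?_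
  simp only [wavg, sub_div]

lemma IsWeight.shift (hw : IsWeight w) {u : ℕ → ℂ} (hu : ∀ n, ‖u n‖ ≤ 1) (h : ℕ) :
    Tendsto (fun K ↦ wavg w (fun n ↦ u (n + h)) K - wavg w u K) atTop (𝓝 0) := by
  induction h with
  | zero => simp
  | succ h ih =>
    have h1 := hw.shift_one (u := fun n ↦ u (n + h)) (fun n ↦ hu _)
    have := h1.add ih
    simp only [add_zero] at this
    refine this.congr fun K ↦ ?_
    rw [show (fun n ↦ u (n + 1 + h)) = fun n ↦ u (n + (h + 1)) by
      funext n; congr 1; ring]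
    ring

lemma IsWeight.shift_tendsto (hw : IsWeight w) {u : ℕ → ℂ} (hu : ∀ n, ‖u n‖ ≤ 1) (h : ℕ) {l : ℂ}
    (hl : Tendsto (wavg w u) atTop (𝓝 l)) :
    Tendsto (wavg w fun n ↦ u (n + h)) atTop (𝓝 l) := by
  have := (hw.shift hu h).add hl
  simp only [zero_add, sub_add_cancel] at this
  exact this

lemma IsWeight.tendsto_of_sub (hw : IsWeight w) {u v : ℕ → ℂ} {l : ℂ}
    (huv : Tendsto (fun n ↦ u n - v n) atTop (𝓝 0)) (hv : Tendsto (wavg w v) atTop (𝓝 l)) :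
    Tendsto (wavg w u) atTop (𝓝 l) := by
  have := (hw.tendsto_zero huv).add hv
  rw [zero_add] at this
  refine this.congr fun K ↦ ?_
  rw [wavg_sub]
  ring

/-- Jensen's inequality for the square. -/
lemma IsWeight.norm_sq_wavg_le (hw : IsWeight w) (u : ℕ → ℂ) (K : ℕ) :
    ‖wavg w u K‖ ^ 2 ≤ ‖wavg w (fun n ↦ u n * conj (u n)) K‖ := by
  set W := ∑ n ∈ range K, w n with hW
  have hW0 : 0 ≤ W := hw.sum_nonneg K
  rcases hW0.eq_or_lt with h0 | h0
  · simp [wavg, ← hW, ← h0]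
  have e1 : wavg w (fun n ↦ u n * conj (u n)) K
      = (((∑ n ∈ range K, w n * ‖u n‖ ^ 2) / W : ℝ) : ℂ) := by
    rw [wavg, ← hW]
    push_cast
    congr 1
    apply sum_congr rfl
    intro n _
    rw [Complex.mul_conj']
  rw [e1, Complex.norm_real, Real.norm_of_nonneg (div_nonneg (Finset.sum_nonneg fun n _ ↦
    mul_nonneg (hw.nonneg n) (sq_nonneg _)) hW0), wavg, ← hW, norm_div, Complex.norm_real,
    Real.norm_of_nonneg hW0, div_pow, div_le_div_iff₀ (by positivity) h0]
  have h1 : ‖∑ n ∈ range K, (w n : ℂ) * u n‖ ≤ ∑ n ∈ range K, w n * ‖u n‖ := by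
    refine (norm_sum_le _ _).trans (le_of_eq ?_)
    apply sum_congr rfl
    intro n _
    rw [norm_mul, Complex.norm_real, Real.norm_of_nonneg (hw.nonneg n)]
  have h2 : (∑ n ∈ range K, w n * ‖u n‖) ^ 2 ≤ W * ∑ n ∈ range K, w n * ‖u n‖ ^ 2 := by
    apply sum_sq_le_sum_mul_sum_of_sq_le_mul
    · intro n _; exact hw.nonneg n
    · intro n _; exact mul_nonneg (hw.nonneg n) (sq_nonneg _)
    · intro n _; exact le_of_eq (by ring)
  calc ‖∑ n ∈ range K, (w n : ℂ) * u n‖ ^ 2 * W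
      ≤ (∑ n ∈ range K, w n * ‖u n‖) ^ 2 * W := by gcongr
    _ ≤ (W * ∑ n ∈ range K, w n * ‖u n‖ ^ 2) * W := by gcongr
    _ = _ := by ring

/-- The van der Corput trick. -/
theorem IsWeight.van_der_corput (hw : IsWeight w) {f : ℕ → ℝ} {s : ℕ}
    (hf : ∀ h : ℕ, 0 < h → Tendsto (wavg w fun n ↦ ex (f (n + h * s) - f n)) atTop (𝓝 0)) :
    Tendsto (wavg w fun n ↦ ex (f n)) atTop (𝓝 0) := by
  -- By shift invariance, a correlation between the shifts `i * s` and `j * s` depends only on `i -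
  -- j`.
  have hpair : ∀ i j : ℕ, Tendsto (wavg w fun n ↦ ex (f (n + i * s)) * conj (ex (f (n + j * s))))
      atTop (𝓝 (if i = j then 1 else 0)) := by
    have hlt : ∀ i j : ℕ, j < i → Tendsto
        (wavg w fun n ↦ ex (f (n + i * s)) * conj (ex (f (n + j * s)))) atTop (𝓝 0) := by
      intro i j hij
      have h1 := hw.shift_tendsto (u := fun n ↦ ex (f (n + (i - j) * s) - f n))
        (fun n ↦ (norm_ex _).le) (j * s) (hf (i - j) (by omega))
      refine h1.congr fun K ↦ ?_
      congr 1
      funext n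
      rw [← ex_sub, add_assoc, ← add_mul, show j + (i - j) = i by omega]
    intro i j
    rcases lt_trichotomy i j with h | h | h
    · rw [if_neg h.ne]
      have := (Complex.continuous_conj.tendsto 0).comp (hlt j i h)
      rw [map_zero] at this
      refine this.congr fun K ↦ ?_
      rw [Function.comp, ← wavg_conj]
      congr 1
      funext n
      rw [map_mul, Complex.conj_conj, mul_comm]
    · subst h
      simp only [mul_conj_ex, if_true]
      exact hw.tendsto_one
    · rw [if_neg h.ne']
      exact hlt i j h
  rw [Metric.tendsto_atTop']
  intro ε hε
  -- Only the diagonal pairs survive, so the average of `|S|²` is eventually below `2 * H`. The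
  -- bound `4 < H * ε ^ 2` gives `2 * H < (3 * H * ε / 4) ^ 2`, and `H * ε / 4` is left for the
  -- shift error.
  obtain ⟨H, hH⟩ := exists_nat_gt (4 / ε ^ 2)
  have hH0 : (0 : ℝ) < H := lt_of_le_of_lt (by positivity) hH
  set S : ℕ → ℂ := fun n ↦ ∑ i ∈ range H, ex (f (n + i * s)) with hS
  have hS1 : Tendsto (fun K ↦ wavg w S K - H * wavg w (fun n ↦ ex (f n)) K) atTop (𝓝 0) := by
    have := tendsto_finsetSum (range H) (fun i _ ↦ hw.shift (u := fun n ↦ ex (f n))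
      (fun n ↦ (norm_ex _).le) (i * s))
    simp only [sum_const_zero] at this
    refine this.congr fun K ↦ ?_
    rw [hS, wavg_sum, sum_sub_distrib]
    simp
  have hS2 : Tendsto (wavg w fun n ↦ S n * conj (S n)) atTop (𝓝 H) := by
    have h1 : (fun n ↦ S n * conj (S n)) = fun n ↦ ∑ i ∈ range H, ∑ j ∈ range H,
        ex (f (n + i * s)) * conj (ex (f (n + j * s))) := by
      funext n
      rw [hS, map_sum, sum_mul_sum]
    have h2 : wavg w (fun n ↦ S n * conj (S n)) = fun K ↦ ∑ i ∈ range H, ∑ j ∈ range H,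
        wavg w (fun n ↦ ex (f (n + i * s)) * conj (ex (f (n + j * s)))) K := by
      funext K
      rw [h1, wavg_sum]
      apply sum_congr rfl
      intro i _
      rw [wavg_sum]
    rw [h2]
    have h3 := tendsto_finsetSum (range H) fun i _ ↦ tendsto_finsetSum (range H)
      fun j _ ↦ hpair i j
    convert h3 using 2
    rw [sum_congr rfl fun i hi ↦ by rw [sum_ite_eq, if_pos hi]]
    simp
  have e1 : ∀ᶠ K in atTop, ‖wavg w (fun n ↦ S n * conj (S n)) K‖ < H + H :=
    hS2.norm.eventually_lt_const (by simpa using hH0)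
  have e2 : ∀ᶠ K in atTop, ‖wavg w S K - H * wavg w (fun n ↦ ex (f n)) K‖ < H * (ε / 4) := by
    have := hS1.norm
    rw [norm_zero] at this
    exact this.eventually_lt_const (by positivity)
  obtain ⟨N, hN⟩ := eventually_atTop.1 (e1.and e2)
  refine ⟨N, fun K hK ↦ ?_⟩
  obtain ⟨hK1, hK2⟩ := hN K hK.le
  rw [dist_zero_right]
  have h4 : ‖wavg w S K‖ ^ 2 < 2 * H := by
    have := hw.norm_sq_wavg_le S K
    linarith
  have h5 : ‖wavg w S K‖ < H * (3 * ε / 4) := by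
    apply lt_of_pow_lt_pow_left₀ 2 (by positivity)
    refine h4.trans ?_
    have h6 : 4 < H * ε ^ 2 := by
      rw [div_lt_iff₀ (by positivity)] at hH
      exact hH
    nlinarith
  have h6 : (H : ℝ) * ‖wavg w (fun n ↦ ex (f n)) K‖ < H * ε := by
    calc (H : ℝ) * ‖wavg w (fun n ↦ ex (f n)) K‖ = ‖(H : ℂ) * wavg w (fun n ↦ ex (f n)) K‖ := by
          rw [norm_mul, Complex.norm_natCast]
      _ = ‖wavg w S K - (wavg w S K - H * wavg w (fun n ↦ ex (f n)) K)‖ := by rw [sub_sub_cancel]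
      _ ≤ ‖wavg w S K‖ + ‖wavg w S K - H * wavg w (fun n ↦ ex (f n)) K‖ := norm_sub_le _ _
      _ < H * (3 * ε / 4) + H * (ε / 4) := add_lt_add h5 hK2
      _ = H * ε := by ring
  exact lt_of_mul_lt_mul_left h6 hH0.le

/-- If the weights are the increments of `g`, then `g` is equidistributed on every scale. -/
theorem IsWeight.tendsto_ex_of_increment (hw : IsWeight w) (hw0 : Tendsto w atTop (𝓝 0))
    {g : ℕ → ℝ} (hg : ∀ᶠ n in atTop, w n = g (n + 1) - g n) {β : ℝ} (hβ : β ≠ 0) :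
    Tendsto (wavg w fun n ↦ ex (β * g n)) atTop (𝓝 0) := by
  set κ : ℂ := ((2 * Real.pi * β : ℝ) : ℂ) * Complex.I with hκ
  have hκ0 : κ ≠ 0 := by
    simp [hκ, Real.pi_ne_zero, hβ]
  set F : ℕ → ℂ := fun n ↦ ex (β * g n) with hF
  -- Error in replacing `κ * w n * F n` by the increment of `F`; it is `O(w n ^ 2) = o(w n)`, and
  -- the increments telescope to a bounded sum.
  set v : ℕ → ℂ := fun n ↦ κ * (w n * F n) - (F (n + 1) - F n) with hv
  have hvw : v =o[atTop] w := by
    have h1 : v =O[atTop] fun n ↦ w n * w n := by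
      apply Asymptotics.IsBigO.of_bound (‖κ‖ ^ 2)
      have hsmall : ∀ᶠ n in atTop, ‖κ * w n‖ ≤ 1 := by
        have : Tendsto (fun n ↦ ‖κ * w n‖) atTop (𝓝 0) := by
          have h := ((Complex.continuous_ofReal.tendsto 0).comp hw0).const_mul κ
          simpa using h.norm
        exact this.eventually_le_const one_pos
      filter_upwards [hg, hsmall] with n hn hs
      have h2 : F (n + 1) = F n * Complex.exp (κ * w n) := by
        rw [hF]
        simp only
        rw [show β * g (n + 1) = β * g n + β * w n by rw [hn]; ring, ex_add]
        congr 1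
        rw [ex, hκ]
        congr 1
        push_cast
        ring
      have h3 : v n = -(F n * (Complex.exp (κ * w n) - 1 - κ * w n)) := by
        rw [hv]
        simp only
        rw [h2]
        ring
      rw [h3, norm_neg, norm_mul, norm_ex, one_mul]
      refine (Complex.norm_exp_sub_one_sub_id_le hs).trans (le_of_eq ?_)
      rw [norm_mul κ, mul_pow, Complex.norm_real, norm_mul (w n), sq ‖w n‖]
    refine h1.trans_isLittleO ?_
    have h2 : w =o[atTop] fun _ ↦ (1 : ℝ) := (Asymptotics.isLittleO_one_iff ℝ).2 hw0
    simpa using h2.mul_isBigO (Asymptotics.isBigO_refl w atTop)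
  have h1 := hw.tendsto_sum_div_of_isLittleO hvw
  have h2 := hw.tendsto_div (F := fun K ↦ F K - F 0) (C := 2) (by
    intro K
    refine (norm_sub_le _ _).trans ?_
    rw [hF]
    simp only [norm_ex]
    norm_num)
  have h3 := (h1.add h2).const_mul κ⁻¹
  simp only [add_zero, mul_zero] at h3
  refine h3.congr fun K ↦ ?_
  rw [← add_div, hv, sum_sub_distrib, ← mul_sum, sum_range_sub, sub_add_cancel, wavg,
    mul_div_assoc, inv_mul_cancel_left₀ hκ0]

end Averages

end HardyRecurrence

/-! ### Finite differences and Weyl's theorem for weighted averages. -/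

namespace HardyRecurrence

open Finset Topology fwdDiff
open scoped ComplexConjugate

section Differences

lemma fwdDiff_eq_sum (f : ℕ → ℝ) (h : ℕ) :
    Δ_[h] f = fun n ↦ ∑ i ∈ range h, Δ_[1] f (n + i) := by
  funext n
  have := sum_range_sub (fun i ↦ f (n + i)) h
  simp only [add_zero] at this
  rw [fwdDiff, ← this]
  simp only [fwdDiff, add_assoc]

lemma fwdDiff_iter_fwdDiff (f : ℕ → ℝ) (h m n : ℕ) :
    Δ_[1] ^[m] (Δ_[h] f) n = ∑ i ∈ range h, Δ_[1] ^[m + 1] f (n + i) := by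
  rw [fwdDiff_eq_sum]
  have h1 : (fun n ↦ ∑ i ∈ range h, Δ_[1] f (n + i))
      = ∑ i ∈ range h, fun n ↦ Δ_[1] f (n + i) := by
    funext n
    rw [Finset.sum_apply]
  rw [h1, fwdDiff_iter_finsetSum, Finset.sum_apply]
  apply sum_congr rfl
  intro i _
  rw [fwdDiff_iter_comp_add, Function.iterate_succ_apply]

lemma tendsto_shift_sub {g : ℕ → ℝ} (hg : Tendsto (Δ_[1] g) atTop (𝓝 0)) (h : ℕ) :
    Tendsto (fun n ↦ g (n + h) - g n) atTop (𝓝 0) := by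
  have h1 := tendsto_finsetSum (range h) fun i _ ↦ (tendsto_add_atTop_iff_nat i).2 hg
  rw [sum_const_zero] at h1
  refine h1.congr fun n ↦ ?_
  exact (congrFun (fwdDiff_eq_sum g h) n).symm

/-- The effect of one van der Corput step: the order drops by one and `c` becomes `h * c`. The
shifts of `g` may be replaced by `g` because `g` varies slowly. -/
lemma tendsto_iter_fwdDiff {f g : ℕ → ℝ} {c : ℝ} {m : ℕ} (hg : Tendsto (Δ_[1] g) atTop (𝓝 0))
    (hf : Tendsto (fun n ↦ Δ_[1] ^[m + 1] f n - c * g n) atTop (𝓝 0)) (h : ℕ) :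
    Tendsto (fun n ↦ Δ_[1] ^[m] (Δ_[h] f) n - (h * c) * g n) atTop (𝓝 0) := by
  have h1 := tendsto_finsetSum (range h) fun i _ ↦ ((tendsto_add_atTop_iff_nat i).2 hf).add
    ((tendsto_shift_sub hg i).const_mul c)
  simp only [mul_zero, add_zero, sum_const_zero] at h1
  refine h1.congr fun n ↦ ?_
  rw [fwdDiff_iter_fwdDiff, sum_congr rfl fun i _ ↦ show
    Δ_[1] ^[m + 1] f (n + i) - c * g (n + i) + c * (g (n + i) - g n)
      = Δ_[1] ^[m + 1] f (n + i) - c * g n by ring, sum_sub_distrib]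
  simp
  ring

lemma periodic_mod_one_mul {z : ℕ → ℝ} {R : ℕ} (hz : ∀ n, ∃ k : ℤ, z (n + R) - z n = k) (h n : ℕ) :
    ∃ k : ℤ, z (n + h * R) - z n = k := by
  induction h with
  | zero => exact ⟨0, by simp⟩
  | succ h ih =>
    obtain ⟨k, hk⟩ := ih
    obtain ⟨l, hl⟩ := hz (n + h * R)
    refine ⟨k + l, ?_⟩
    push_cast
    rw [← hk, ← hl, show n + (h + 1) * R = n + h * R + R by ring]
    ring

variable {w : ℕ → ℝ}

/-- Weyl's theorem for sequences with an irrational leading coefficient. -/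
theorem IsWeight.tendsto_ex_of_irrational (hw : IsWeight w) {R : ℕ} (hR : 0 < R) (e : ℕ) :
    ∀ {p z : ℕ → ℝ} {c : ℝ}, Irrational c → Tendsto (Δ_[1] ^[e + 1] p) atTop (𝓝 c) →
      (∀ n, ∃ k : ℤ, z (n + R) - z n = k) →
      Tendsto (wavg w fun n ↦ ex (p n + z n)) atTop (𝓝 0) := by
  induction e with
  | zero =>
    intro p z c hc hp hz
    rw [zero_add, Function.iterate_one] at hp
    have hp1 : Tendsto (fun n ↦ p (n + R) - p n) atTop (𝓝 (R * c)) := by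
      have h1 := tendsto_finsetSum (range R) fun i _ ↦ (tendsto_add_atTop_iff_nat i).2 hp
      rw [sum_const, card_range, nsmul_eq_mul] at h1
      refine h1.congr fun n ↦ ?_
      exact (congrFun (fwdDiff_eq_sum p R) n).symm
    -- Shifting by `R` asymptotically multiplies the sequence by `ex (R * c) ≠ 1`, yet leaves the
    -- averages unchanged in the limit, so they tend to zero.
    have hne : ex (R * c) ≠ 1 := by
      rw [Ne, ex_eq_one_iff]
      rintro ⟨k, hk⟩
      exact (hc.natCast_mul hR.ne').ne_int k hk
    have h2 := hw.shift (u := fun n ↦ ex (p n + z n)) (fun n ↦ (norm_ex _).le) R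
    have h3 : Tendsto (fun n ↦ ex (p (n + R) + z (n + R)) - ex (R * c) * ex (p n + z n)) atTop
        (𝓝 0) := by
      have h4 : Tendsto (fun n ↦ ‖ex (p (n + R) - p n) - ex (R * c)‖) atTop (𝓝 0) := by
        have := ((continuous_ex.tendsto _).comp hp1).sub_const (ex (R * c))
        simpa using this.norm
      rw [tendsto_zero_iff_norm_tendsto_zero]
      refine h4.congr fun n ↦ ?_
      obtain ⟨k, hk⟩ := hz n
      rw [show p (n + R) + z (n + R) = (p (n + R) - p n) + (p n + z n) + (k : ℝ) by rw [← hk]; ring,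
        ex_add_int, ex_add, ← sub_mul, norm_mul, norm_ex, mul_one]
    have h4 := hw.tendsto_zero h3
    have h5 := (h4.sub h2).const_mul (1 - ex (R * c))⁻¹
    rw [sub_zero, mul_zero] at h5
    refine h5.congr fun K ↦ ?_
    rw [wavg_sub, wavg_const_mul]
    have : 1 - ex (R * c) ≠ 0 := sub_ne_zero.2 hne.symm
    field_simp
    ring
  | succ e ih =>
    intro p z c hc hp hz
    -- Shifts by multiples of `R` make `z` disappear modulo 1.
    apply hw.van_der_corput (s := R)
    intro h hh
    have h1 : Tendsto (Δ_[1] ^[e + 1] (Δ_[h * R] p)) atTop (𝓝 ((h * R : ℕ) * c)) := by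
      have h2 := tendsto_iter_fwdDiff (f := p) (g := fun _ ↦ 1) (c := c) (m := e + 1)
        (by rw [fwdDiff_const]; exact tendsto_const_nhds)
        (by simpa using hp.sub_const c) (h * R)
      simpa using h2.add_const ((h * R : ℕ) * c)
    have h2 := ih (z := fun _ ↦ 0) (hc.natCast_mul (Nat.mul_pos hh hR).ne') h1
      (fun n ↦ ⟨0, by simp⟩)
    refine h2.congr fun K ↦ ?_
    congr 1
    funext n
    obtain ⟨k, hk⟩ := periodic_mod_one_mul hz h n
    rw [show p (n + h * R) + z (n + h * R) - (p n + z n) = Δ_[h * R] p n + 0 + (k : ℝ) by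
      rw [← hk, fwdDiff]; ring, ex_add_int]

/-- The sequence `q` is, up to a constant, a rational multiple of an integer polynomial. -/
def RationalUpToConst (q : ℕ → ℝ) : Prop :=
  ∃ R : ℕ, 0 < R ∧ ∃ (P : Polynomial ℤ) (κ : ℝ), ∀ n : ℕ, R * q n = P.eval (n : ℤ) + κ

/-- The denominator `R` itself is a period modulo 1, since `R` divides `P(n + R) - P(n)`. -/
lemma RationalUpToConst.periodic {q : ℕ → ℝ} (hq : RationalUpToConst q) :
    ∃ R : ℕ, 0 < R ∧ ∀ n, ∃ k : ℤ, q (n + R) - q n = k := by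
  obtain ⟨R, hR, P, κ, hP⟩ := hq
  refine ⟨R, hR, fun n ↦ ?_⟩
  obtain ⟨k, hk⟩ := Polynomial.sub_dvd_eval_sub ((n + R : ℕ) : ℤ) (n : ℤ) P
  refine ⟨k, ?_⟩
  have hR' : (R : ℝ) ≠ 0 := by positivity
  apply mul_left_cancel₀ hR'
  rw [mul_sub, hP, hP]
  have : ((P.eval ((n + R : ℕ) : ℤ) - P.eval (n : ℤ) : ℤ) : ℝ) = R * k := by
    rw [hk]; push_cast; ring
  push_cast at this
  push_cast
  linarith

lemma RationalUpToConst.add {q r : ℕ → ℝ} (hq : RationalUpToConst q) (hr : RationalUpToConst r) :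
    RationalUpToConst (q + r) := by
  obtain ⟨R, hR, P, κ, hP⟩ := hq
  obtain ⟨R', hR', P', κ', hP'⟩ := hr
  refine ⟨R * R', Nat.mul_pos hR hR', Polynomial.C (R' : ℤ) * P + Polynomial.C (R : ℤ) * P',
    R' * κ + R * κ', fun n ↦ ?_⟩
  have h1 := hP n
  have h2 := hP' n
  simp only [Polynomial.eval_add, Polynomial.eval_mul, Polynomial.eval_C, Pi.add_apply]
  push_cast
  linear_combination (R' : ℝ) * h1 + (R : ℝ) * h2

lemma rationalUpToConst_choose (c : ℚ) (D : ℕ) :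
    RationalUpToConst fun n ↦ (c : ℝ) * (n.choose D : ℝ) := by
  refine ⟨c.den * D.factorial, Nat.mul_pos c.den_pos D.factorial_pos,
    Polynomial.C c.num * descPochhammer ℤ D, 0, fun n ↦ ?_⟩
  rw [Polynomial.eval_mul, Polynomial.eval_C, descPochhammer_eval_eq_descFactorial,
    Nat.descFactorial_eq_factorial_mul_choose]
  have h1 : (c : ℝ) * c.den = c.num := by exact_mod_cast Rat.mul_den_eq_num c
  push_cast
  linear_combination (D.factorial : ℝ) * (n.choose D : ℝ) * h1

lemma fwdDiff_choose_succ (j : ℕ) :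
    Δ_[1] (fun n : ℕ ↦ (n.choose (j + 1) : ℝ)) = fun n ↦ (n.choose j : ℝ) := by
  funext n
  simp [fwdDiff, Nat.choose_succ_succ]

lemma fwdDiff_iter_choose_self (j : ℕ) :
    Δ_[1] ^[j] (fun n : ℕ ↦ (n.choose j : ℝ)) = fun _ ↦ 1 := by
  induction j with
  | zero => funext n; simp
  | succ j ih => rw [Function.iterate_succ_apply, fwdDiff_choose_succ, ih]

lemma fwdDiff_iter_const_mul (c : ℝ) (f : ℕ → ℝ) (m : ℕ) :
    Δ_[1] ^[m] (fun n ↦ c * f n) = fun n ↦ c * Δ_[1] ^[m] f n :=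
  fwdDiff_iter_const_smul 1 c f m

lemma fwdDiff_iter_sub (f g : ℕ → ℝ) (m : ℕ) :
    Δ_[1] ^[m] (fun n ↦ f n - g n) = fun n ↦ Δ_[1] ^[m] f n - Δ_[1] ^[m] g n := by
  have h := fwdDiff_iter_add 1 f ((-1 : ℝ) • g) m
  rw [fwdDiff_iter_const_smul] at h
  rw [show (fun n ↦ f n - g n) = f + (-1 : ℝ) • g by funext n; simp; ring, h]
  funext n
  simp
  ring

lemma fwdDiff_iter_zero (m : ℕ) : Δ_[1] ^[m] (fun _ : ℕ ↦ (0 : ℝ)) = fun _ ↦ 0 := by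
  induction m with
  | zero => rfl
  | succ m ih => rw [Function.iterate_succ_apply, fwdDiff_const, ih]

/-- A polynomial sequence has, up to a constant, rational coefficients, or splits off an
irrational leading term. -/
theorem rational_or_irrational (D : ℕ) : ∀ q : ℕ → ℝ, Δ_[1] ^[D] q = (fun _ ↦ 0) →
    RationalUpToConst q ∨ ∃ (e : ℕ) (c : ℝ) (p z : ℕ → ℝ), Irrational c ∧
      Δ_[1] ^[e + 1] p = (fun _ ↦ c) ∧ RationalUpToConst z ∧ q = p + z := by
  induction D with
  | zero =>
    intro q hq
    refine Or.inl ⟨1, one_pos, 0, 0, fun n ↦ ?_⟩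
    have := congrFun hq n
    simp at this
    simp [this]
  | succ D ih =>
    intro q hq
    obtain ⟨c, hc⟩ : ∃ c, Δ_[1] ^[D] q = fun _ ↦ c := by
      refine ⟨Δ_[1] ^[D] q 0, ?_⟩
      funext n
      rw [Function.iterate_succ_apply'] at hq
      induction n with
      | zero => rfl
      | succ n ihn =>
        rw [← ihn, ← sub_eq_zero]
        exact congrFun hq n
    -- A constant sequence goes into `κ`, rational or not; only nonconstant terms matter.
    rcases D with _ | D
    · refine Or.inl ⟨1, one_pos, 0, c, fun n ↦ ?_⟩
      have := congrFun hc n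
      simp at this
      simp [this]
    · by_cases hirr : Irrational c
      -- An irrational top difference ends the search with `p = q`; a rational one is stripped off
      -- as a multiple of a binomial coefficient, which lowers the degree.
      · refine Or.inr ⟨D, c, q, fun _ ↦ 0, hirr, hc, ⟨1, one_pos, 0, 0, by simp⟩, ?_⟩
        funext n
        simp
      · obtain ⟨r, rfl⟩ : ∃ r : ℚ, (r : ℝ) = c := by
          simpa [Irrational] using hirr
        have hz := rationalUpToConst_choose r (D + 1)
        set z : ℕ → ℝ := fun n ↦ (r : ℝ) * (n.choose (D + 1) : ℝ) with hzdef
        have h1 : Δ_[1] ^[D + 1] (fun n ↦ q n - z n) = fun _ ↦ 0 := by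
          rw [fwdDiff_iter_sub, hc, hzdef, fwdDiff_iter_const_mul, fwdDiff_iter_choose_self]
          funext n
          simp
        rcases ih _ h1 with h | ⟨e, c, p, z', hc, hp, hz', hq'⟩
        · left
          have := h.add hz
          convert this using 1
          funext n
          simp
        · right
          refine ⟨e, c, p, z' + z, hc, hp, hz'.add hz, ?_⟩
          rw [← add_assoc, ← hq']
          funext n
          simp

/-- As `b` is almost constant over a period, averaging over `R` consecutive shifts separates the
mean of the periodic factor from the average of `ex (b n)`. -/
lemma IsWeight.tendsto_periodic_mul (hw : IsWeight w) {z b : ℕ → ℝ} {R : ℕ} (hR : 0 < R)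
    (hz : ∀ n, ∃ k : ℤ, z (n + R) - z n = k) (hb : Tendsto (Δ_[1] b) atTop (𝓝 0))
    (hb0 : Tendsto (wavg w fun n ↦ ex (b n)) atTop (𝓝 0)) :
    Tendsto (wavg w fun n ↦ ex (b n + z n)) atTop (𝓝 0) := by
  have hper : ∀ n, ∑ j ∈ range R, ex (z (n + j)) = ∑ j ∈ range R, ex (z j) := by
    intro n
    induction n with
    | zero => simp
    | succ n ih =>
      rw [← ih]
      have h1 := sum_range_succ (fun j ↦ ex (z (n + j))) R
      have h2 := sum_range_succ' (fun j ↦ ex (z (n + j))) R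
      obtain ⟨k, hk⟩ := hz n
      have h3 : ex (z (n + R)) = ex (z n) := by
        rw [show z (n + R) = z n + k by rw [← hk]; ring, ex_add_int]
      rw [h1, h3, add_zero] at h2
      have h4 := add_right_cancel h2
      rw [h4]
      apply sum_congr rfl
      intro j _
      congr 2
      ring
  have h1 : ∀ j, Tendsto (fun K ↦ wavg w (fun n ↦ ex (b n) * ex (z (n + j))) K
      - wavg w (fun n ↦ ex (b n + z n)) K) atTop (𝓝 0) := by
    intro j
    have h2 := hw.shift (u := fun n ↦ ex (b n + z n)) (fun n ↦ (norm_ex _).le) j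
    have h3 : Tendsto (fun n ↦ ex (b n) * ex (z (n + j)) - ex (b (n + j) + z (n + j))) atTop
        (𝓝 0) := by
      rw [tendsto_zero_iff_norm_tendsto_zero]
      have h4 : Tendsto (fun n ↦ ‖1 - ex (b (n + j) - b n)‖) atTop (𝓝 0) := by
        have := ((continuous_ex.tendsto _).comp (tendsto_shift_sub hb j)).const_sub 1
        simpa [ex_zero] using this.norm
      refine h4.congr fun n ↦ ?_
      rw [show b (n + j) + z (n + j) = (b (n + j) - b n) + b n + z (n + j) by ring, ex_add, ex_add,
        mul_assoc, ← one_sub_mul, norm_mul, norm_mul, norm_ex, norm_ex, mul_one, mul_one]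
    have h4 := (hw.tendsto_zero h3).add h2
    rw [add_zero] at h4
    refine h4.congr fun K ↦ ?_
    rw [wavg_sub]
    ring
  have h2 := tendsto_finsetSum (range R) fun j _ ↦ h1 j
  rw [sum_const_zero] at h2
  have h3 := hb0.const_mul (∑ j ∈ range R, ex (z j))
  rw [mul_zero] at h3
  have h4 := (h3.sub h2).const_mul (R : ℂ)⁻¹
  rw [sub_zero, mul_zero] at h4
  refine h4.congr fun K ↦ ?_
  rw [sum_sub_distrib, ← wavg_sum, sum_const, card_range, nsmul_eq_mul, ← wavg_const_mul]
  have h5 : (fun n ↦ ∑ j ∈ range R, ex (b n) * ex (z (n + j)))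
      = fun n ↦ (∑ j ∈ range R, ex (z j)) * ex (b n) := by
    funext n
    rw [← mul_sum, hper, mul_comm]
  rw [h5, sub_sub_cancel, inv_mul_cancel_left₀]
  exact_mod_cast hR.ne'

/-- The exponential averages of the sum of a polynomial sequence and a sequence whose `m`-th
difference is asymptotic to a multiple of `g`. -/
theorem IsWeight.tendsto_ex_add_poly (hw : IsWeight w) {g : ℕ → ℝ}
    (hg : Tendsto (Δ_[1] g) atTop (𝓝 0))
    (hgw : ∀ β : ℝ, β ≠ 0 → Tendsto (wavg w fun n ↦ ex (β * g n)) atTop (𝓝 0)) (D m : ℕ) :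
    ∀ {b q : ℕ → ℝ} {c : ℝ}, c ≠ 0 → Δ_[1] ^[D] q = (fun _ ↦ 0) →
      Tendsto (fun n ↦ Δ_[1] ^[m] b n - c * g n) atTop (𝓝 0) →
      Tendsto (wavg w fun n ↦ ex (b n + q n)) atTop (𝓝 0) := by
  induction m with
  | zero =>
    intro b q c hc hq hb
    rw [Function.iterate_zero] at hb
    simp only [id] at hb
    have hb1 : Tendsto (Δ_[1] b) atTop (𝓝 0) := by
      have h1 := (((tendsto_add_atTop_iff_nat 1).2 hb).sub hb).add (hg.const_mul c)
      rw [sub_zero, mul_zero, add_zero] at h1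
      refine h1.congr fun n ↦ ?_
      simp only [fwdDiff]
      ring
    rcases rational_or_irrational D q hq with h | ⟨e, c', p, z, hc', hp, hz, rfl⟩
    · obtain ⟨R, hR, hz⟩ := h.periodic
      refine hw.tendsto_periodic_mul hR hz hb1 ?_
      refine hw.tendsto_of_sub ?_ (hgw c hc)
      rw [tendsto_zero_iff_norm_tendsto_zero]
      have h4 : Tendsto (fun n ↦ ‖ex (b n - c * g n) - 1‖) atTop (𝓝 0) := by
        have := ((continuous_ex.tendsto _).comp hb).sub_const 1
        simpa [ex_zero] using this.norm
      refine h4.congr fun n ↦ ?_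
      rw [show b n = (b n - c * g n) + c * g n by ring, ex_add, ← sub_one_mul, norm_mul, norm_ex,
        mul_one]
      congr 3
      ring
    · obtain ⟨R, hR, hz⟩ := hz.periodic
      -- All differences of `b` vanish in the limit, so `b` can be added to `p` without affecting
      -- its irrational leading difference.
      have hbe : Tendsto (Δ_[1] ^[e + 1] b) atTop (𝓝 0) := by
        clear hp
        induction e with
        | zero => simpa using hb1
        | succ e ih =>
          rw [Function.iterate_succ_apply']
          have := ((tendsto_add_atTop_iff_nat 1).2 ih).sub ih
          rw [sub_zero] at this
          exact this
      have h1 : Tendsto (Δ_[1] ^[e + 1] (b + p)) atTop (𝓝 c') := by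
        rw [fwdDiff_iter_add, hp]
        have := hbe.add_const c'
        rw [zero_add] at this
        exact this
      have := hw.tendsto_ex_of_irrational hR e hc' h1 hz
      refine this.congr fun K ↦ ?_
      congr 1
      funext n
      simp only [Pi.add_apply, add_assoc]
  | succ m ih =>
    intro b q c hc hq hb
    apply hw.van_der_corput (s := 1)
    intro h hh
    rw [mul_one]
    have hh' : (h : ℝ) ≠ 0 := by positivity
    have h1 := tendsto_iter_fwdDiff hg hb h
    have h2 : Δ_[1] ^[D] (Δ_[h] q) = fun _ ↦ 0 := by
      funext n
      rw [fwdDiff_iter_fwdDiff]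
      apply sum_eq_zero
      intro i _
      rw [Function.iterate_succ_apply', hq, fwdDiff_const]
    have h3 := ih (mul_ne_zero hh' hc) h2 h1
    refine h3.congr fun K ↦ ?_
    congr 1
    funext n
    simp only [fwdDiff]
    congr 1
    ring

end Differences

end HardyRecurrence

/-! ### Hardy fields: eventual signs of derivatives and differences. -/

namespace HardyRecurrence

open Finset Topology fwdDiff

/-- The sequence `u` has eventually a constant sign, in the weak sense. -/
def EventuallySigned (u : ℕ → ℝ) : Prop :=
  (∀ᶠ n in atTop, 0 ≤ u n) ∨ ∀ᶠ n in atTop, u n ≤ 0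

section HardyField

/-- A nonzero element of the field is invertible, hence has no zeros far out, and continuity fixes
its sign. -/
lemma MemHardy.iterate_deriv {a : ℝ → ℝ} (ha : MemHardy a) (k : ℕ) :
    (∀ᶠ x in atTop, DifferentiableAt ℝ (deriv^[k] a) x) ∧
      ((∀ᶠ x in atTop, 0 ≤ deriv^[k] a x) ∨ ∀ᶠ x in atTop, deriv^[k] a x ≤ 0) := by
  obtain ⟨H, hH, haH⟩ := ha
  have hmem : ∀ k, ((deriv^[k] a : ℝ → ℝ) : Germ (atTop : Filter ℝ) ℝ) ∈ H := by
    intro k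
    induction k with
    | zero => exact haH
    | succ k ih =>
      rw [Function.iterate_succ_apply']
      exact (hH.deriv_mem _ ih).2
  have hd := (hH.deriv_mem _ (hmem k)).1
  refine ⟨hd, ?_⟩
  set f := deriv^[k] a with hf
  by_cases h0 : (f : Germ (atTop : Filter ℝ) ℝ) = 0
  · left
    have h1 : f =ᶠ[atTop] fun _ ↦ 0 := Germ.coe_eq.1 h0
    filter_upwards [h1] with x hx
    exact hx.ge
  · obtain ⟨⟨g, hg⟩, hfg⟩ := hH.isField.mul_inv_cancel
      (a := ⟨(f : Germ (atTop : Filter ℝ) ℝ), hmem k⟩) (fun h ↦ h0 (congrArg Subtype.val h))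
    have hfg' : (f : Germ (atTop : Filter ℝ) ℝ) * g = 1 := congrArg Subtype.val hfg
    obtain ⟨g, rfl⟩ : ∃ g' : ℝ → ℝ, (g' : Germ (atTop : Filter ℝ) ℝ) = g := Quotient.exists_rep g
    have h1 : f * g =ᶠ[atTop] fun _ ↦ 1 := Germ.coe_eq.1 hfg'
    obtain ⟨X, hX⟩ := eventually_atTop.1 (h1.and hd)
    have hne : ∀ x, X ≤ x → f x ≠ 0 := by
      intro x hx h
      have := (hX x hx).1
      simp [h] at this
    have hcont : ∀ y, ContinuousOn f (Set.Icc X y) := fun y x hx ↦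
      (hX x hx.1).2.continuousAt.continuousWithinAt
    rcases (hne X le_rfl).lt_or_gt with h | h
    · right
      filter_upwards [eventually_ge_atTop X] with y hy
      by_contra! hpos
      obtain ⟨x, hx, hx0⟩ := intermediate_value_Icc hy (hcont y) ⟨h.le, hpos.le⟩
      exact hne x hx.1 hx0
    · left
      filter_upwards [eventually_ge_atTop X] with y hy
      by_contra! hneg
      obtain ⟨x, hx, hx0⟩ := intermediate_value_Icc' hy (hcont y) ⟨hneg.le, h.le⟩
      exact hne x hx.1 hx0

lemma eventually_hasDerivAt_iter_fwdDiff {F F' : ℝ → ℝ}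
    (h : ∀ᶠ x in atTop, HasDerivAt F (F' x) x) (j : ℕ) :
    ∀ᶠ x in atTop, HasDerivAt (Δ_[1] ^[j] F) (Δ_[1] ^[j] F' x) x := by
  induction j with
  | zero => exact h
  | succ j ih =>
    have h1 := (tendsto_atTop_add_const_right atTop (1 : ℝ) tendsto_id).eventually ih
    filter_upwards [ih, h1] with x hx hx1
    rw [Function.iterate_succ_apply', Function.iterate_succ_apply']
    exact (HasDerivAt.comp_add_const x 1 hx1).sub hx

/-- The derivative of `Δ^j (F i)` is `Δ^j (F (i + 1))`. If the latter is nonnegative, `Δ^j (F i)`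
increases and its own difference is nonnegative. -/
lemma eventually_iter_fwdDiff_nonneg {F : ℕ → ℝ → ℝ}
    (hF : ∀ j, ∀ᶠ x in atTop, HasDerivAt (F j) (F (j + 1) x) x) (j : ℕ) :
    ∀ i, (∀ᶠ x in atTop, 0 ≤ F (i + j) x) → ∀ᶠ x in atTop, 0 ≤ Δ_[1] ^[j] (F i) x := by
  induction j with
  | zero => intro i h; exact h
  | succ j ih =>
    intro i h
    have h1 := ih (i + 1) (by simpa only [add_assoc, add_comm 1 j] using h)
    obtain ⟨X, hX⟩ := eventually_atTop.1 (h1.and (eventually_hasDerivAt_iter_fwdDiff (hF i) j))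
    have hmono : MonotoneOn (Δ_[1] ^[j] (F i)) (Set.Ici X) := by
      apply monotoneOn_of_deriv_nonneg (convex_Ici X)
      · exact fun x hx ↦ (hX x hx).2.continuousAt.continuousWithinAt
      · intro x hx
        rw [interior_Ici] at hx
        exact (hX x (le_of_lt hx)).2.differentiableAt.differentiableWithinAt
      · intro x hx
        rw [interior_Ici] at hx
        rw [(hX x (le_of_lt hx)).2.deriv]
        exact (hX x (le_of_lt hx)).1
    filter_upwards [eventually_ge_atTop X] with x hx
    rw [Function.iterate_succ_apply', fwdDiff, sub_nonneg]
    exact hmono (Set.mem_Ici.2 hx) (Set.mem_Ici.2 (by linarith)) (by linarith)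

lemma fwdDiff_iter_natCast (f : ℝ → ℝ) (k n : ℕ) :
    Δ_[1] ^[k] (fun n : ℕ ↦ f n) n = Δ_[1] ^[k] f (n : ℝ) := by
  induction k generalizing n with
  | zero => rfl
  | succ k ih =>
    rw [Function.iterate_succ_apply', Function.iterate_succ_apply', fwdDiff, fwdDiff, ih, ih]
    push_cast
    rfl

lemma MemHardy.eventuallySigned {a : ℝ → ℝ} (ha : MemHardy a) (k : ℕ) :
    EventuallySigned (Δ_[1] ^[k] fun n : ℕ ↦ a n) := by
  have hF : ∀ j, ∀ᶠ x in atTop, HasDerivAt (deriv^[j] a) (deriv^[j + 1] a x) x := by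
    intro j
    filter_upwards [(ha.iterate_deriv j).1] with x hx
    rw [Function.iterate_succ_apply']
    exact hx.hasDerivAt
  rcases (ha.iterate_deriv k).2 with h | h
  · left
    have h1 := eventually_iter_fwdDiff_nonneg hF k 0 (by simpa using h)
    filter_upwards [tendsto_natCast_atTop_atTop.eventually h1] with n hn
    rw [fwdDiff_iter_natCast]
    exact hn
  · right
    have h1 := eventually_iter_fwdDiff_nonneg (F := fun j ↦ (-1 : ℝ) • deriv^[j] a) (fun j ↦ by
      filter_upwards [hF j] with x hx
      exact hx.const_smul (-1 : ℝ)) k 0 (by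
      filter_upwards [h] with x hx
      simpa using hx)
    filter_upwards [tendsto_natCast_atTop_atTop.eventually h1] with n hn
    rw [fwdDiff_iter_natCast]
    rw [fwdDiff_iter_const_smul] at hn
    simpa using hn

end HardyField

/-! ### Structure of regular sequences and choice of the weights. -/

section Sequences

lemma eventually_monotone_shift {u : ℕ → ℝ} (h : ∀ᶠ n in atTop, 0 ≤ Δ_[1] u n) :
    ∃ N, Monotone fun n ↦ u (n + N) := by
  obtain ⟨N, hN⟩ := eventually_atTop.1 h
  refine ⟨N, monotone_nat_of_le_succ fun n ↦ ?_⟩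
  have := hN (n + N) (by omega)
  rw [fwdDiff, sub_nonneg] at this
  rwa [add_right_comm]

lemma eventually_antitone_shift {u : ℕ → ℝ} (h : ∀ᶠ n in atTop, Δ_[1] u n ≤ 0) :
    ∃ N, Antitone fun n ↦ u (n + N) := by
  obtain ⟨N, hN⟩ := eventually_atTop.1 h
  refine ⟨N, antitone_nat_of_succ_le fun n ↦ ?_⟩
  have := hN (n + N) (by omega)
  rw [fwdDiff, sub_nonpos] at this
  rwa [add_right_comm]

lemma EventuallySigned.tendsto {u : ℕ → ℝ} (h : EventuallySigned (Δ_[1] u)) :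
    (∃ l, Tendsto u atTop (𝓝 l)) ∨ Tendsto u atTop atTop ∨ Tendsto u atTop atBot := by
  rcases h with h | h
  · obtain ⟨N, hN⟩ := eventually_monotone_shift h
    rcases tendsto_atTop_of_monotone hN with h | ⟨l, h⟩
    · exact Or.inr (Or.inl ((tendsto_add_atTop_iff_nat N).1 h))
    · exact Or.inl ⟨l, (tendsto_add_atTop_iff_nat N).1 h⟩
  · obtain ⟨N, hN⟩ := eventually_antitone_shift h
    rcases tendsto_atTop_of_antitone hN with h | ⟨l, h⟩
    · exact Or.inr (Or.inr ((tendsto_add_atTop_iff_nat N).1 h))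
    · exact Or.inl ⟨l, (tendsto_add_atTop_iff_nat N).1 h⟩

lemma EventuallySigned.of_tendsto_zero {u : ℕ → ℝ} (h : EventuallySigned (Δ_[1] u))
    (hu : Tendsto u atTop (𝓝 0)) : EventuallySigned u := by
  rcases h with h | h
  · obtain ⟨N, hN⟩ := eventually_monotone_shift h
    right
    filter_upwards [eventually_ge_atTop N] with n hn
    have := hN.ge_of_tendsto ((tendsto_add_atTop_iff_nat N).2 hu) (n - N)
    rwa [Nat.sub_add_cancel hn] at this
  · obtain ⟨N, hN⟩ := eventually_antitone_shift h
    left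
    filter_upwards [eventually_ge_atTop N] with n hn
    have := hN.le_of_tendsto ((tendsto_add_atTop_iff_nat N).2 hu) (n - N)
    rwa [Nat.sub_add_cancel hn] at this

lemma tendsto_choose_atTop (k : ℕ) :
    Tendsto (fun n : ℕ ↦ (n.choose (k + 1) : ℝ)) atTop atTop := by
  have h0 : ∀ j, j ≤ (j + k).choose (k + 1) := by
    intro j
    induction j with
    | zero => exact Nat.zero_le _
    | succ j ih =>
      rw [show j + 1 + k = j + k + 1 by ring, Nat.choose_succ_succ']
      have := Nat.choose_pos (show k ≤ j + k by omega)
      omega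
  have h : Tendsto (fun n : ℕ ↦ n.choose (k + 1)) atTop atTop :=
    (tendsto_add_atTop_iff_nat k).1 (tendsto_atTop_mono h0 tendsto_id)
  exact tendsto_natCast_atTop_atTop.comp h

/-- Sum the lower bound `k` times; halving the constant each time absorbs the initial values. -/
lemma exists_choose_le {c : ℝ} (hc : 0 < c) (k : ℕ) : ∀ f : ℕ → ℝ,
    (∀ᶠ n in atTop, c ≤ Δ_[1] ^[k] f n) →
    ∃ c', 0 < c' ∧ ∀ᶠ n : ℕ in atTop, c' * (n.choose k : ℝ) ≤ f n := by
  induction k with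
  | zero =>
    intro f h
    exact ⟨c, hc, by simpa using h⟩
  | succ k ih =>
    intro f h
    obtain ⟨c', hc', h'⟩ := ih (Δ_[1] f) h
    refine ⟨c' / 2, by positivity, ?_⟩
    obtain ⟨N, hN⟩ := eventually_monotone_shift
      (u := fun n ↦ f n - c' * (n.choose (k + 1) : ℝ)) (by
        filter_upwards [h'] with n hn
        have h1 := congrFun (fwdDiff_choose_succ k) n
        simp only [fwdDiff] at h1 hn ⊢
        rw [← h1] at hn
        linarith)
    have h2 := (tendsto_choose_atTop k).const_mul_atTop (show 0 < c' / 2 by positivity)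
    filter_upwards [eventually_ge_atTop N,
      h2.eventually_ge_atTop (-(f N - c' * (N.choose (k + 1) : ℝ)))] with n hn hn2
    have h3 := hN (Nat.zero_le (n - N))
    simp only [zero_add, Nat.sub_add_cancel hn] at h3
    linarith

lemma not_tendsto_div_pow {c : ℝ} (hc : 0 < c) {k : ℕ} {f : ℕ → ℝ}
    (h : ∀ᶠ n in atTop, c ≤ Δ_[1] ^[k] f n) :
    ¬ Tendsto (fun n : ℕ ↦ f n / (n : ℝ) ^ k) atTop (𝓝 0) := by
  intro hf
  obtain ⟨c', hc', h'⟩ := exists_choose_le hc k f h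
  have hδ : 0 < c' * ((1 / 2) ^ k / (k.factorial : ℝ)) := by positivity
  obtain ⟨n, hn1, hn2, hn3⟩ := ((hf.eventually_lt_const hδ).and
    (h'.and (eventually_ge_atTop (2 * k + 1)))).exists
  have hn0 : (0 : ℝ) < n := by exact_mod_cast (show 0 < n by omega)
  rw [div_lt_iff₀ (by positivity)] at hn1
  have h1 : ((n : ℝ) / 2) ^ k ≤ k.factorial * n.choose k := by
    have h2 : (((n + 1 - k : ℕ) ^ k : ℕ) : ℝ) ≤ k.factorial * n.choose k := by
      have := Nat.pow_sub_le_descFactorial n k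
      rw [Nat.descFactorial_eq_factorial_mul_choose] at this
      exact_mod_cast this
    refine le_trans ?_ h2
    push_cast
    gcongr
    rw [Nat.cast_sub (by omega)]
    push_cast
    have : (2 * k + 1 : ℝ) ≤ n := by exact_mod_cast hn3
    linarith
  have h3 : c' * ((1 / 2) ^ k / (k.factorial : ℝ)) * (n : ℝ) ^ k ≤ c' * n.choose k := by
    rw [mul_assoc]
    gcongr
    rw [div_mul_eq_mul_div, div_le_iff₀ (by positivity), ← mul_pow]
    calc (1 / 2 * (n : ℝ)) ^ k = (n / 2 : ℝ) ^ k := by congr 1; ring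
      _ ≤ _ := h1
      _ = _ := mul_comm _ _
  linarith

/-- `Δ^k a` is eventually monotone, so it has a limit in the extended reals; a nonzero one would
make `a` at least of order `n ^ k`. -/
lemma tendsto_iter_fwdDiff_of_growth {a : ℕ → ℝ} (hs : ∀ k, EventuallySigned (Δ_[1] ^[k] a)) {k : ℕ}
    (hk : Tendsto (fun n : ℕ ↦ a n / (n : ℝ) ^ k) atTop (𝓝 0)) :
    Tendsto (Δ_[1] ^[k] a) atTop (𝓝 0) := by
  have hpos : ∀ c : ℝ, 0 < c → ¬ ∀ᶠ n in atTop, c ≤ Δ_[1] ^[k] a n := fun c hc h ↦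
    not_tendsto_div_pow hc h hk
  have hneg : ∀ c : ℝ, c < 0 → ¬ ∀ᶠ n in atTop, Δ_[1] ^[k] a n ≤ c := by
    intro c hc h
    refine not_tendsto_div_pow (c := -c) (k := k) (f := (-1 : ℝ) • a) (by linarith) ?_ ?_
    · rw [fwdDiff_iter_const_smul]
      filter_upwards [h] with n hn
      simpa using hn
    · simpa [neg_div] using hk.neg
  have h1 := hs (k + 1)
  rw [Function.iterate_succ'] at h1
  rcases h1.tendsto with ⟨l, h⟩ | h | h
  · rcases lt_trichotomy l 0 with hl | hl | hl
    · exact absurd (h.eventually_le_const (show l < l / 2 by linarith)) (hneg _ (by linarith))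
    · rwa [hl] at h
    · exact absurd (h.eventually_const_le (show l / 2 < l by linarith)) (hpos _ (by linarith))
  · exact absurd (h.eventually_ge_atTop 1) (hpos 1 one_pos)
  · exact absurd (h.eventually_le_atBot (-1)) (hneg (-1) (by norm_num))

/-- A regular sequence is the sum of a polynomial sequence and a sequence which tends to zero or
has an iterated difference that tends slowly to infinity. -/
theorem exists_poly_add (j : ℕ) : ∀ b : ℕ → ℝ, Tendsto (Δ_[1] ^[j] b) atTop (𝓝 0) →
    EventuallySigned (Δ_[1] ^[j + 1] b) → ∃ q : ℕ → ℝ, Δ_[1] ^[j] q = (fun _ ↦ 0) ∧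
      (Tendsto (fun n ↦ b n - q n) atTop (𝓝 0) ∨ ∃ m,
        (Tendsto (Δ_[1] ^[m] fun n ↦ b n - q n) atTop atTop ∨
          Tendsto (Δ_[1] ^[m] fun n ↦ b n - q n) atTop atBot) ∧
        Tendsto (Δ_[1] ^[m + 1] fun n ↦ b n - q n) atTop (𝓝 0) ∧
        EventuallySigned (Δ_[1] ^[m + 2] fun n ↦ b n - q n)) := by
  induction j with
  | zero =>
    intro b hb _
    exact ⟨fun _ ↦ 0, rfl, Or.inl (by simpa using hb)⟩
  | succ j ih =>
    intro b hb hs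
    have hs' : EventuallySigned (Δ_[1] (Δ_[1] ^[j] b)) := by
      rw [← Function.iterate_succ_apply' (f := Δ_[1])]
      apply EventuallySigned.of_tendsto_zero _ hb
      rwa [← Function.iterate_succ_apply' (f := Δ_[1])]
    -- If `Δ^j b` has a finite limit `l`, subtracting `l * choose n j` makes the limit zero and the
    -- induction continues; an infinite limit is the slow alternative with `m = j`.
    rcases hs'.tendsto with ⟨l, h⟩ | h
    · set P : ℕ → ℝ := fun n ↦ l * (n.choose j : ℝ) with hP
      have hPj : Δ_[1] ^[j] P = fun _ ↦ l := by
        rw [hP, fwdDiff_iter_const_mul, fwdDiff_iter_choose_self]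
        funext n
        simp
      have hPj1 : Δ_[1] ^[j + 1] P = fun _ ↦ 0 := by
        rw [Function.iterate_succ_apply', hPj, fwdDiff_const]
      obtain ⟨q, hq, hq'⟩ := ih (fun n ↦ b n - P n) (by
          rw [fwdDiff_iter_sub, hPj]
          simpa using h.sub_const l) (by
          rw [fwdDiff_iter_sub, hPj1]
          simp only [sub_zero]
          rwa [← Function.iterate_succ_apply' (f := Δ_[1])] at hs')
      refine ⟨P + q, ?_, ?_⟩
      · rw [fwdDiff_iter_add, hPj1, Function.iterate_succ_apply', hq, fwdDiff_const]
        funext n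
        simp
      · simpa only [Pi.add_apply, sub_sub] using hq'
    · refine ⟨fun _ ↦ 0, fwdDiff_iter_zero _, Or.inr ⟨j, ?_, ?_, ?_⟩⟩
      · simpa using h
      · simpa using hb
      · simpa using hs

/-- The weights telescope to `g → ∞`, and being bounded and eventually monotone they have bounded
variation. -/
lemma isWeight_of_increment {g w : ℕ → ℝ} {N : ℕ} (hw0 : ∀ n, 0 ≤ w n)
    (hN : ∀ n, N ≤ n → w n = g (n + 1) - g n) (hg : Tendsto g atTop atTop) {B : ℝ}
    (hB : ∀ n, w n ≤ B) (hs : EventuallySigned (Δ_[1] w)) : IsWeight w := by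
  refine ⟨hw0, ?_, ?_⟩
  · have h1 : ∀ K, N ≤ K → ∑ n ∈ range K, w n = g K + (∑ n ∈ range N, w n - g N) := by
      intro K hK
      induction K, hK using Nat.le_induction with
      | base => ring
      | succ K hK ih =>
        rw [sum_range_succ, ih, hN K hK]
        ring
    have h2 := tendsto_atTop_add_const_right atTop (∑ n ∈ range N, w n - g N) hg
    refine h2.congr' ?_
    filter_upwards [eventually_ge_atTop N] with K hK
    exact (h1 K hK).symm
  · have key : ∀ ε : ℝ, |ε| = 1 → (∃ M, ∀ n, M ≤ n → 0 ≤ ε * Δ_[1] w n) →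
        ∃ C, ∀ K, ∑ n ∈ range K, |w (n + 1) - w n| ≤ C := by
      rintro ε hε ⟨M, hM⟩
      have h1 : ∀ K, M ≤ K → ∑ n ∈ range K, |w (n + 1) - w n|
          = ∑ n ∈ range M, |w (n + 1) - w n| + ε * (w K - w M) := by
        intro K hK
        induction K, hK using Nat.le_induction with
        | base => ring
        | succ K hK ih =>
          have h2 := abs_of_nonneg (hM K hK)
          rw [abs_mul, hε, one_mul, fwdDiff] at h2
          rw [sum_range_succ, ih, h2]
          ring
      have h2 : ∀ K, M ≤ K → ∑ n ∈ range K, |w (n + 1) - w n|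
          ≤ ∑ n ∈ range M, |w (n + 1) - w n| + B := by
        intro K hK
        rw [h1 K hK]
        gcongr
        refine (le_abs_self _).trans ?_
        rw [abs_mul, hε, one_mul, abs_le]
        constructor <;> linarith [hw0 K, hw0 M, hB K, hB M]
      refine ⟨_, fun K ↦ le_trans ?_ (h2 (max K M) (le_max_right _ _))⟩
      exact sum_le_sum_of_subset_of_nonneg (range_mono (le_max_left _ _))
        fun _ _ _ ↦ abs_nonneg _
    rcases hs with h | h
    · exact key 1 (by simp) (by simpa using eventually_atTop.1 h)
    · exact key (-1) (by simp) (by simpa using eventually_atTop.1 h)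

/-- There are weights for which all nonzero multiples of `a` are equidistributed mod 1. -/
theorem exists_weight {a : ℕ → ℝ} (hs : ∀ k, EventuallySigned (Δ_[1] ^[k] a)) {k : ℕ}
    (hk : Tendsto (fun n : ℕ ↦ a n / (n : ℝ) ^ k) atTop (𝓝 0))
    (haway : ∀ (p : Polynomial ℤ) (c : ℝ),
      Tendsto (fun n : ℕ ↦ |a n - c * (p.eval (n : ℤ) : ℤ)|) atTop atTop) (M : ℕ) :
    ∃ w : ℕ → ℝ, IsWeight w ∧ (∀ n < M, w n = 0) ∧
      ∀ t : ℝ, t ≠ 0 → Tendsto (wavg w fun n ↦ ex (t * a n)) atTop (𝓝 0) := by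
  obtain ⟨q, hq, h⟩ := exists_poly_add k a (tendsto_iter_fwdDiff_of_growth hs hk) (hs _)
  have hqt : ∀ t : ℝ, Δ_[1] ^[k] (fun n ↦ t * q n) = fun _ ↦ 0 := by
    intro t
    rw [fwdDiff_iter_const_mul, hq]
    simp
  have slow : ∀ (ε : ℝ) (m : ℕ), |ε| = 1 →
      Tendsto (fun n ↦ ε * Δ_[1] ^[m] (fun n ↦ a n - q n) n) atTop atTop →
      Tendsto (Δ_[1] ^[m + 1] fun n ↦ a n - q n) atTop (𝓝 0) →
      EventuallySigned (Δ_[1] ^[m + 2] fun n ↦ a n - q n) →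
      ∃ w : ℕ → ℝ, IsWeight w ∧ (∀ n < M, w n = 0) ∧
      ∀ t : ℝ, t ≠ 0 → Tendsto (wavg w fun n ↦ ex (t * a n)) atTop (𝓝 0) := by
    -- The sign `ε = ±1` normalizes the divergence to `g → +∞`.
    intro ε m hε hm hm1 hm2
    set g : ℕ → ℝ := fun n ↦ ε * Δ_[1] ^[m] (fun n ↦ a n - q n) n with hg
    have hg1 : Δ_[1] g = fun n ↦ ε * Δ_[1] ^[m + 1] (fun n ↦ a n - q n) n := by
      funext n
      rw [hg, Function.iterate_succ_apply']
      simp only [fwdDiff]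
      ring
    have hg1' : Tendsto (Δ_[1] g) atTop (𝓝 0) := by
      rw [hg1]
      simpa using hm1.const_mul ε
    have hε0 : ε ≠ 0 := by
      rintro rfl
      simp at hε
    have hε2 : ε * ε = 1 := by
      rw [← abs_mul_abs_self, hε, one_mul]
    have hg2 : EventuallySigned (Δ_[1] (Δ_[1] g)) := by
      have h1 : Δ_[1] (Δ_[1] g) = fun n ↦ ε * Δ_[1] ^[m + 2] (fun n ↦ a n - q n) n := by
        rw [hg1, Function.iterate_succ_apply' _ (m + 1)]
        funext n
        simp only [fwdDiff]
        ring
      rw [h1]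
      rcases eq_or_eq_neg_of_abs_eq hε with rfl | rfl
      · simpa using hm2
      · rcases hm2 with h | h
        · exact Or.inr (by simpa using h)
        · exact Or.inl (by simpa using h)
    have hpos : ∀ᶠ n in atTop, 0 ≤ Δ_[1] g n := by
      rcases hg2.of_tendsto_zero hg1' with h | h
      · exact h
      · exfalso
        obtain ⟨N, hN⟩ := eventually_antitone_shift h
        obtain ⟨n, hn⟩ := (((tendsto_add_atTop_iff_nat N).2 hm).eventually_gt_atTop (g N)).exists
        have := hN (Nat.zero_le n)
        simp only [zero_add] at this
        exact absurd hn (not_lt.2 this)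
    obtain ⟨N, hN⟩ := eventually_atTop.1 hpos
    -- The cutoff `N` ensures nonnegativity; `M` is the prescribed range where the weights must
    -- vanish.
    set w : ℕ → ℝ := fun n ↦ if n < max N M then 0 else Δ_[1] g n with hw
    have hwN : ∀ n, max N M ≤ n → w n = Δ_[1] g n := fun n hn ↦ if_neg (not_lt.2 hn)
    have hwg : w =ᶠ[atTop] Δ_[1] g := by
      filter_upwards [eventually_ge_atTop (max N M)] with n hn
      exact hwN n hn
    have hw0 : ∀ n, 0 ≤ w n := by
      intro n
      rcases lt_or_ge n (max N M) with h | h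
      · exact (if_pos h).ge
      · rw [hwN n h]
        exact hN n ((le_max_left _ _).trans h)
    have hwlim : Tendsto w atTop (𝓝 0) := hg1'.congr' hwg.symm
    obtain ⟨B, hB⟩ := hwlim.bddAbove_range
    have hwW : IsWeight w := by
      refine isWeight_of_increment hw0 hwN hm (fun n ↦ hB ⟨n, rfl⟩) ?_
      have h1 : ∀ᶠ n in atTop, Δ_[1] w n = Δ_[1] (Δ_[1] g) n := by
        filter_upwards [eventually_ge_atTop (max N M)] with n hn
        rw [fwdDiff, hwN n hn, hwN (n + 1) (by omega)]
        rfl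
      rcases hg2 with h | h
      · left
        filter_upwards [h1, h] with n h1 h2
        rwa [h1]
      · right
        filter_upwards [h1, h] with n h1 h2
        rwa [h1]
    refine ⟨w, hwW, fun n hn ↦ if_pos (lt_max_of_lt_right hn), fun t ht ↦ ?_⟩
    have h1 := hwW.tendsto_ex_add_poly hg1' (fun β hβ ↦ hwW.tendsto_ex_of_increment hwlim hwg hβ)
      k m (b := fun n ↦ t * (a n - q n)) (c := t * ε) (mul_ne_zero ht hε0) (hqt t) (by
        apply tendsto_const_nhds.congr
        intro n
        rw [fwdDiff_iter_const_mul, hg]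
        simp only
        linear_combination (t * Δ_[1] ^[m] (fun n ↦ a n - q n) n) * hε2)
    refine h1.congr fun K ↦ ?_
    congr 1
    funext n
    congr 1
    ring
  rcases h with h | ⟨m, hm | hm, hm1, hm2⟩
  · set w : ℕ → ℝ := fun n ↦ if n < M then 0 else 1 with hw
    have hwW : IsWeight w := by
      refine isWeight_of_increment (g := fun n ↦ (n : ℝ)) (N := M) (B := 1) ?_ ?_
        tendsto_natCast_atTop_atTop ?_ (Or.inl ?_)
      · intro n
        simp only [hw]
        split_ifs <;> norm_num
      · intro n hn
        simp [hw, not_lt.2 hn]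
      · intro n
        simp only [hw]
        split_ifs <;> norm_num
      · filter_upwards [eventually_ge_atTop M] with n hn
        simp [fwdDiff, hw, not_lt.2 hn, not_lt.2 (hn.trans (Nat.le_succ n))]
    refine ⟨w, hwW, fun n hn ↦ if_pos hn, fun t ht ↦ ?_⟩
    rcases rational_or_irrational k _ (hqt t) with ⟨R, hR, P, κ, hP⟩ | ⟨e, c, p, z, hc, hp, hz, hqz⟩
    · exfalso
      have hR' : (R : ℝ) ≠ 0 := by positivity
      -- If `t * q` were rational up to a constant, `a` would stay at bounded distance from `P / (R
      -- * t)`.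
      have h1 : Tendsto (fun n : ℕ ↦ |a n - (1 / (R * t)) * (P.eval (n : ℤ) : ℤ)|) atTop
          (𝓝 |0 + κ / (R * t)|) := by
        refine ((h.add_const (κ / (R * t))).abs).congr fun n ↦ ?_
        congr 1
        have h2 := hP n
        have h3 : q n = (1 / (R * t)) * (P.eval (n : ℤ) : ℤ) + κ / (R * t) := by
          field_simp
          linarith
        rw [h3]
        ring
      exact not_tendsto_nhds_of_tendsto_atTop (haway P _) _ h1
    · obtain ⟨R, hR, hz⟩ := hz.periodic
      have h1 := hwW.tendsto_ex_of_irrational hR e hc (by rw [hp]; exact tendsto_const_nhds) hz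
      refine hwW.tendsto_of_sub ?_ h1
      rw [tendsto_zero_iff_norm_tendsto_zero]
      have h4 : Tendsto (fun n ↦ ‖ex (t * (a n - q n)) - 1‖) atTop (𝓝 0) := by
        have := ((continuous_ex.tendsto _).comp (h.const_mul t)).sub_const 1
        simpa [ex_zero] using this.norm
      refine h4.congr fun n ↦ ?_
      have h5 : t * q n = p n + z n := congrFun hqz n
      rw [show t * a n = t * (a n - q n) + (p n + z n) by rw [← h5]; ring, ex_add _ (p n + z n),
        ← sub_one_mul, norm_mul, norm_ex, mul_one]
  · exact slow 1 m (by simp) (by simpa using hm) hm1 hm2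
  · exact slow (-1) m (by simp) 
      ((tendsto_neg_atBot_atTop.comp hm).congr fun n ↦ (neg_one_mul _).symm) hm1 hm2

end Sequences

end HardyRecurrence

/-! ### From multiples of `a` to its integer part. -/

namespace HardyRecurrence

open Finset Topology
open scoped ComplexConjugate

section IntegerPart

lemma fourier_eq_ex (m : ℤ) (y : ℝ) : fourier m (y : UnitAddCircle) = ex (m * y) := by
  rw [fourier_coe_apply, ex]
  congr 1
  push_cast
  ring

/-- A `1`-periodic weight vanishing at the integers. -/
noncomputable def bump (y : ℝ) : ℂ := (2 - ex y - ex (-y)) / 4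

lemma bump_eq (y : ℝ) : bump y = ((1 - Real.cos (2 * Real.pi * y)) / 2 : ℝ) := by
  have h : ex y + ex (-y) = (2 * Real.cos (2 * Real.pi * y) : ℝ) := by
    rw [← conj_ex, Complex.add_conj, ex, Complex.exp_ofReal_mul_I_re]
  rw [bump, sub_sub, h]
  push_cast
  ring

lemma norm_bump_le (y : ℝ) : ‖bump y‖ ≤ 1 := by
  rw [bump_eq, Complex.norm_real, Real.norm_eq_abs, abs_le]
  constructor <;> linarith [Real.neg_one_le_cos (2 * Real.pi * y), Real.cos_le_one (2 * Real.pi * y)]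

lemma bump_sub_int (y : ℝ) (k : ℤ) : bump (y - k) = bump y := by
  rw [bump, bump, neg_sub, sub_eq_add_neg (k : ℝ), add_comm (k : ℝ), ex_add_int]
  congr 3
  rw [sub_eq_add_neg, ← Int.cast_neg, ex_add_int]

variable {w : ℕ → ℝ}

lemma IsWeight.tendsto_bump (hw : IsWeight w) {a : ℕ → ℝ}
    (ha : ∀ t : ℝ, t ≠ 0 → Tendsto (wavg w fun n ↦ ex (t * a n)) atTop (𝓝 0)) :
    Tendsto (wavg w fun n ↦ bump (a n)) atTop (𝓝 (1 / 2)) := by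
  have h1 := ha 1 one_ne_zero
  have h2 := ha (-1) (by norm_num)
  have h3 := ((hw.tendsto_one.const_mul 2).sub (h1.add h2)).const_mul (1 / 4)
  have e : (1 / 4 : ℂ) * (2 * 1 - (0 + 0)) = 1 / 2 := by norm_num
  rw [e] at h3
  refine h3.congr fun K ↦ ?_
  rw [← wavg_add, ← wavg_const_mul, ← wavg_sub, ← wavg_const_mul]
  congr 1
  funext n
  rw [bump, one_mul, neg_one_mul]
  ring

/-- For a character `F` of frequency `m` this is the hypothesis at `θ + m ≠ 0`; linearity and
uniform density of trigonometric polynomials give the rest. -/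
lemma IsWeight.tendsto_ex_mul_continuous (hw : IsWeight w) {a : ℕ → ℝ}
    (ha : ∀ t : ℝ, t ≠ 0 → Tendsto (wavg w fun n ↦ ex (t * a n)) atTop (𝓝 0)) {θ : ℝ}
    (hθ : ∀ m : ℤ, θ + m ≠ 0) (F : C(UnitAddCircle, ℂ)) :
    Tendsto (wavg w fun n ↦ ex (θ * a n) * F (a n : UnitAddCircle)) atTop (𝓝 0) := by
  have hspan : ∀ P ∈ Submodule.span ℂ (Set.range (@fourier 1)),
      Tendsto (wavg w fun n ↦ ex (θ * a n) * P (a n : UnitAddCircle)) atTop (𝓝 0) := by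
    intro P hP
    induction hP using Submodule.span_induction with
    | mem P hP =>
      obtain ⟨m, rfl⟩ := hP
      refine (ha (θ + m) (hθ m)).congr fun K ↦ ?_
      congr 1
      funext n
      rw [fourier_eq_ex, ← ex_add, add_mul]
    | zero =>
      have := hw.tendsto_zero (v := fun _ ↦ 0) tendsto_const_nhds
      simpa using this
    | add P Q _ _ hP hQ =>
      have := hP.add hQ
      rw [add_zero] at this
      refine this.congr fun K ↦ ?_
      rw [← wavg_add]
      simp only [ContinuousMap.add_apply, mul_add]
    | smul c P _ hP =>
      have := hP.const_mul c
      rw [mul_zero] at this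
      refine this.congr fun K ↦ ?_
      rw [← wavg_const_mul]
      simp only [ContinuousMap.smul_apply, smul_eq_mul, mul_left_comm]
  rw [Metric.tendsto_atTop']
  intro ε hε
  have hF : F ∈ (Submodule.span ℂ (Set.range (@fourier 1))).topologicalClosure := by
    rw [span_fourier_closure_eq_top]
    trivial
  obtain ⟨P, hP, hFP⟩ := Metric.mem_closure_iff.1 hF (ε / 2) (by positivity)
  have h1 := (hspan P hP).norm
  rw [norm_zero] at h1
  obtain ⟨N, hN⟩ := eventually_atTop.1 (h1.eventually_lt_const (show 0 < ε / 2 by positivity))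
  refine ⟨N, fun K hK ↦ ?_⟩
  rw [dist_zero_right]
  have h2 : ‖wavg w (fun n ↦ ex (θ * a n) * F (a n : UnitAddCircle)
      - ex (θ * a n) * P (a n : UnitAddCircle)) K‖ ≤ ε / 2 := by
    apply hw.norm_wavg_le (by positivity)
    intro n
    rw [← mul_sub, norm_mul, norm_ex, one_mul, ← dist_eq_norm]
    exact (ContinuousMap.dist_apply_le_dist _).trans hFP.le
  rw [wavg_sub] at h2
  have h3 := hN K hK.le
  calc _ = ‖(wavg w (fun n ↦ ex (θ * a n) * F (a n : UnitAddCircle)) K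
        - wavg w (fun n ↦ ex (θ * a n) * P (a n : UnitAddCircle)) K)
        + wavg w (fun n ↦ ex (θ * a n) * P (a n : UnitAddCircle)) K‖ := by rw [sub_add_cancel]
    _ ≤ _ := norm_add_le _ _
    _ < ε / 2 + ε / 2 := add_lt_add_of_le_of_lt h2 h3
    _ = ε := by ring

/-- If all nonzero multiples of `a` are equidistributed, then so is the integer part of `a`, with
respect to all nontrivial characters. -/
theorem IsWeight.tendsto_floor (hw : IsWeight w) {a : ℕ → ℝ}
    (ha : ∀ t : ℝ, t ≠ 0 → Tendsto (wavg w fun n ↦ ex (t * a n)) atTop (𝓝 0)) {θ : ℝ}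
    (hθ : ∀ m : ℤ, θ + m ≠ 0) :
    Tendsto (wavg w fun n ↦ bump (a n) * ex (⌊a n⌋ * θ)) atTop (𝓝 0) := by
  -- Here `ex (⌊y⌋ * θ)` equals `ex (θ * y)` times `ex (-θ * fract y)`. The last factor may jump at
  -- the integers; `bump` vanishes there, so the product with it is continuous on the circle.
  set f : ℝ → ℂ := fun y ↦ bump y * ex (-(θ * y)) with hf
  have hbump : ∀ k : ℤ, bump k = 0 := by
    intro k
    rw [bump, ← Int.cast_neg, ex_int, ex_int]
    norm_num
  have hcont : Continuous f := by
    have h1 := continuous_ex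
    unfold f bump
    fun_prop
  have hF := AddCircle.liftIco_zero_continuous (p := (1 : ℝ)) (f := f)
    (by
      have h0 := hbump 0
      have h1 := hbump 1
      rw [Int.cast_zero] at h0
      rw [Int.cast_one] at h1
      simp only [hf, h0, h1, zero_mul]) hcont.continuousOn
  refine (hw.tendsto_ex_mul_continuous ha hθ ⟨_, hF⟩).congr fun K ↦ ?_
  congr 1
  funext n
  have h1 : ((a n : ℝ) : UnitAddCircle) = ((Int.fract (a n) : ℝ) : UnitAddCircle) := by
    rw [← Int.self_sub_floor, AddCircle.coe_sub, sub_eq_self.2]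
    exact (AddCircle.coe_eq_zero_iff (1 : ℝ)).2 ⟨⌊a n⌋, by simp⟩
  rw [ContinuousMap.coe_mk, h1, AddCircle.liftIco_zero_coe_apply
    ⟨Int.fract_nonneg _, Int.fract_lt_one _⟩, hf]
  simp only
  rw [mul_left_comm, ← ex_add, ← Int.self_sub_floor, bump_sub_int]
  congr 2
  ring

end IntegerPart

/-! ### Intersectivity by a limiting spectral measure. -/

section Intersectivity

lemma ex_natCast_mul (n : ℕ) (x : ℝ) : ex (n * x) = ex x ^ n := by
  induction n with
  | zero => simp [ex_zero]
  | succ n ih =>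
    rw [pow_succ, ← ih, ← ex_add]
    congr 1
    push_cast
    ring

lemma sum_ex_div {N : ℕ} (hN : 0 < N) (k : ℤ) :
    ∑ j ∈ range N, ex (k * (j / N)) = if (N : ℤ) ∣ k then (N : ℂ) else 0 := by
  have hN' : (N : ℝ) ≠ 0 := by positivity
  have h1 : ∀ j : ℕ, ex (k * (j / N)) = ex (k / N) ^ j := by
    intro j
    rw [← ex_natCast_mul]
    congr 1
    ring
  simp only [h1]
  split_ifs with h
  · obtain ⟨l, rfl⟩ := h
    have : ((N * l : ℤ) : ℝ) / N = (l : ℤ) := by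
      push_cast
      field_simp
    rw [this, ex_int]
    simp
  · have hne : ex (k / N) ≠ 1 := by
      rw [Ne, ex_eq_one_iff]
      rintro ⟨l, hl⟩
      apply h
      refine ⟨l, ?_⟩
      rw [div_eq_iff hN'] at hl
      rw [mul_comm]
      exact_mod_cast hl
    rw [geom_sum_eq hne, ← ex_natCast_mul, mul_div_cancel₀ _ hN', ex_int, sub_self, zero_div]

/-- The squared modulus of the Fourier transform of `E` on the `N`-th roots of unity, normalized. -/
noncomputable def energyWeight (E : Finset ℕ) (N j : ℕ) : ℝ :=
  ‖∑ x ∈ E, ex (-(x * (j / N)))‖ ^ 2 / (N * #E)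

/-- The measure on the circle with the weights `energyWeight`. -/
noncomputable def energyMeasure (E : Finset ℕ) (N : ℕ) : Measure UnitAddCircle :=
  ∑ j ∈ range N, ENNReal.ofReal (energyWeight E N j) •
    Measure.dirac (((j / N : ℝ)) : UnitAddCircle)

lemma energyWeight_nonneg (E : Finset ℕ) (N j : ℕ) : 0 ≤ energyWeight E N j := by
  unfold energyWeight
  positivity

/-- Expand the square and use orthogonality of characters modulo `N`: the Fourier coefficient at `s`
counts the pairs in `E` with difference `s` modulo `N`. -/
lemma sum_energyWeight_mul {E : Finset ℕ} {N : ℕ} (hN : 0 < N) (s : ℤ) :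
    ∑ j ∈ range N, (energyWeight E N j : ℂ) * ex (s * (j / N))
      = #{p ∈ E ×ˢ E | (N : ℤ) ∣ s + p.2 - p.1} / #E := by
  have hN' : (N : ℂ) ≠ 0 := by exact_mod_cast hN.ne'
  have h1 : ∀ j, (energyWeight E N j : ℂ) * ex (s * (j / N))
      = (∑ p ∈ E ×ˢ E, ex (((s + p.2 - p.1 : ℤ) : ℝ) * (j / N))) / (N * #E) := by
    intro j
    rw [energyWeight]
    push_cast
    rw [← Complex.mul_conj', map_sum, sum_mul_sum, ← sum_product', div_mul_eq_mul_div, sum_mul]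
    congr 1
    apply sum_congr rfl
    intro p _
    rw [conj_ex, neg_neg, ← ex_add, ← ex_add]
    congr 1
    ring
  simp only [h1]
  rw [← sum_div, sum_comm]
  simp only [sum_ex_div hN]
  rw [← sum_filter, sum_const, nsmul_eq_mul, mul_comm (N : ℂ), mul_div_mul_right _ _ hN']

lemma integral_energyMeasure (E : Finset ℕ) (N : ℕ) (f : C(UnitAddCircle, ℂ)) :
    ∫ x, f x ∂(energyMeasure E N)
      = ∑ j ∈ range N, (energyWeight E N j : ℂ) * f ((j / N : ℝ) : UnitAddCircle) := by
  rw [energyMeasure, integral_finsetSum_measure]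
  · apply sum_congr rfl
    intro j _
    rw [integral_smul_measure, integral_dirac, ENNReal.toReal_ofReal (energyWeight_nonneg _ _ _),
      Complex.real_smul]
  · intro j _
    apply Integrable.smul_measure _ ENNReal.ofReal_ne_top
    exact integrable_dirac (by simp)

lemma energyMeasure_univ {E : Finset ℕ} {M N : ℕ} (hN : 0 < N) (hMN : M ≤ N) (hE : E ⊆ range M)
    (hE0 : E.Nonempty) : energyMeasure E N Set.univ = 1 := by
  have h1 : ∑ j ∈ range N, energyWeight E N j = 1 := by
    have h := sum_energyWeight_mul (E := E) hN 0
    have h2 : #{p ∈ E ×ˢ E | (N : ℤ) ∣ 0 + p.2 - p.1} = #E := by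
      rw [← diag_card E]
      congr 1
      ext ⟨x, y⟩
      simp only [mem_filter, mem_product, mem_diag]
      constructor
      · rintro ⟨⟨hx, hy⟩, hd⟩
        have hx' := mem_range.1 (hE hx)
        have hy' := mem_range.1 (hE hy)
        refine ⟨hx, ?_⟩
        have := Int.eq_zero_of_abs_lt_dvd hd (by rw [abs_lt]; omega)
        omega
      · rintro ⟨hx, rfl⟩
        simp [hx]
    rw [h2, div_self (by exact_mod_cast hE0.card_pos.ne')] at h
    simp only [Int.cast_zero, zero_mul, ex_zero, mul_one] at h
    exact_mod_cast h
  simp only [energyMeasure, Measure.coe_finsetSum, Finset.sum_apply, Measure.smul_apply,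
    measure_univ, smul_eq_mul, mul_one]
  rw [← ENNReal.ofReal_sum_of_nonneg fun _ _ ↦ energyWeight_nonneg _ _ _, h1, ENNReal.ofReal_one]

lemma le_energyMeasure_zero {E : Finset ℕ} {N : ℕ} (hN : 0 < N) :
    ENNReal.ofReal (#E / N) ≤ energyMeasure E N {0} := by
  have h0 : energyWeight E N 0 = #E / N := by
    rw [energyWeight]
    simp only [Nat.cast_zero, zero_div, mul_zero, neg_zero, ex_zero, sum_const, nsmul_eq_mul,
      mul_one, Complex.norm_natCast]
    rcases eq_or_ne (#E : ℝ) 0 with h | h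
    · simp [h]
    · field_simp
  simp only [energyMeasure, Measure.coe_finsetSum, Finset.sum_apply]
  refine le_trans ?_ (single_le_sum (f := fun j : ℕ ↦ (ENNReal.ofReal (energyWeight E N j) •
    Measure.dirac ((j / N : ℝ) : UnitAddCircle)) {0}) (fun _ _ ↦ zero_le) (mem_range.2 hN))
  simp [h0]

/-- A set of integers which carries a bounded sequence of trigonometric polynomials converging
pointwise to a multiple of the indicator function of the trivial character is intersective. -/
theorem intersective_of_trigPolynomials {S : Set ℤ} {P : ℕ → C(UnitAddCircle, ℂ)}
    (hspan : ∀ K, P K ∈ Submodule.span ℂ (fourier '' S)) (hbdd : ∀ K x, ‖P K x‖ ≤ 1)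
    (hne : ∀ x ≠ 0, Tendsto (fun K ↦ P K x) atTop (𝓝 0)) {c : ℂ} (hc : c ≠ 0)
    (h0 : Tendsto (fun K ↦ P K 0) atTop (𝓝 c)) {δ : ℝ} (hδ : 0 < δ) :
    ∃ M : ℕ, 0 < M ∧ ∀ E ⊆ range M, δ * M ≤ #E → ∃ x ∈ E, ∃ y ∈ E, (y : ℤ) - x ∈ S := by
  by_contra! H
  choose E hEM hEδ hES using fun M : ℕ ↦ H (M + 1) M.succ_pos
  have hE0 : ∀ M, (E M).Nonempty := by
    intro M
    rw [← card_pos]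
    have h1 : 0 < δ * (M + 1 : ℕ) := by positivity
    exact_mod_cast h1.trans_le (hEδ M)
  -- The modulus is twice the window length, so for `|s| ≤ M` a difference congruent to `s` is equal
  -- to `s`.
  let ν : ℕ → ProbabilityMeasure UnitAddCircle := fun M ↦
    ⟨energyMeasure (E M) (2 * (M + 1)),
      ⟨energyMeasure_univ (by omega) (by omega) (hEM M) (hE0 M)⟩⟩
  -- Compactness of the space of probability measures gives a limit along the ultrafilter, with no
  -- passage to a subsequence.
  let U : Ultrafilter ℕ := hyperfilter ℕ
  have hU : (U : Filter ℕ) ≤ atTop := Nat.hyperfilter_le_atTop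
  obtain ⟨ρ, hρ⟩ : ∃ ρ, Tendsto ν U (𝓝 ρ) := ⟨_, (U.map ν).le_nhds_lim⟩
  have hfour : ∀ s ∈ S, ∫ x, fourier s x ∂(ρ : Measure UnitAddCircle) = 0 := by
    intro s hs
    have h1 := (ProbabilityMeasure.tendsto_iff_forall_integral_rclike_tendsto ℂ).1 hρ
      (BoundedContinuousFunction.mkOfCompact (fourier s))
    refine tendsto_nhds_unique h1 (tendsto_const_nhds.congr' ?_)
    apply hU
    filter_upwards [eventually_ge_atTop s.natAbs] with M hM
    symm
    have h2 := integral_energyMeasure (E M) (2 * (M + 1)) (fourier s)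
    simp only [fourier_eq_ex] at h2
    rw [sum_energyWeight_mul (by omega)] at h2
    have h3 : #{p ∈ E M ×ˢ E M | ((2 * (M + 1) : ℕ) : ℤ) ∣ s + p.2 - p.1} = 0 := by
      rw [card_eq_zero, filter_eq_empty_iff]
      rintro ⟨x, y⟩ hxy hd
      rw [mem_product] at hxy
      have hx' := mem_range.1 (hEM M hxy.1)
      have hy' := mem_range.1 (hEM M hxy.2)
      have h4 := Int.eq_zero_of_abs_lt_dvd hd (by rw [abs_lt]; push_cast; omega)
      apply hES M y hxy.2 x hxy.1
      have : (x : ℤ) - y = s := by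
        simp only at h4
        omega
      rwa [this]
    rw [h3, Nat.cast_zero, zero_div] at h2
    exact h2
  have hint : ∀ K, ∫ x, P K x ∂(ρ : Measure UnitAddCircle) = 0 := by
    intro K
    have hI : ∀ f : C(UnitAddCircle, ℂ), Integrable f (ρ : Measure UnitAddCircle) := fun f ↦
      (BoundedContinuousFunction.mkOfCompact f).integrable _
    have hK := hspan K
    generalize P K = f at hK
    induction hK using Submodule.span_induction with
    | mem f hf =>
      obtain ⟨s, hs, rfl⟩ := hf
      exact hfour s hs
    | zero => simp
    | add f g _ _ hf hg =>
      simp only [ContinuousMap.add_apply]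
      rw [integral_add (hI f) (hI g), hf, hg, add_zero]
    | smul b f _ hf =>
      simp only [ContinuousMap.smul_apply]
      rw [integral_smul, hf, smul_zero]
  -- Dominated convergence gives `c * ρ {0} = 0`, whereas the closed-set portmanteau inequality
  -- gives `ρ {0} ≥ δ / 2`.
  have hlim : Tendsto (fun K ↦ ∫ x, P K x ∂(ρ : Measure UnitAddCircle)) atTop
      (𝓝 (∫ x, Set.indicator {0} (fun _ ↦ c) x ∂(ρ : Measure UnitAddCircle))) := by
    refine tendsto_integral_of_dominated_convergence (fun _ ↦ 1)
      (fun K ↦ (P K).continuous.aestronglyMeasurable) (integrable_const _)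
      (fun K ↦ Eventually.of_forall (hbdd K)) (Eventually.of_forall fun x ↦ ?_)
    by_cases hx : x = 0
    · subst hx
      simpa using h0
    · rw [Set.indicator_of_notMem (by simpa using hx)]
      exact hne x hx
  simp only [hint] at hlim
  have h1 := tendsto_nhds_unique hlim tendsto_const_nhds
  rw [integral_indicator_const _ (measurableSet_singleton 0), smul_eq_zero, or_iff_left hc,
    measureReal_eq_zero_iff] at h1
  have h2 := ProbabilityMeasure.limsup_measure_closed_le_of_tendsto hρ (isClosed_singleton (x := 0))
  rw [h1] at h2
  have h3 : ENNReal.ofReal (δ / 2) ≤ limsup (fun i ↦ (ν i : Measure UnitAddCircle) {0}) U := by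
    refine le_limsup_of_frequently_le (Eventually.frequently (Eventually.of_forall fun M ↦ ?_))
    refine le_trans (ENNReal.ofReal_le_ofReal ?_) (le_energyMeasure_zero (by omega))
    have := hEδ M
    rw [le_div_iff₀ (by positivity)]
    push_cast at this ⊢
    linarith
  have h4 := h3.trans h2
  rw [nonpos_iff_eq_zero, ENNReal.ofReal_eq_zero] at h4
  linarith

end Intersectivity

end HardyRecurrence

/-! ### Recurrence and differences in dense sets. -/

namespace HardyRecurrence

open Finset Topology

section Recurrence

/-- Every dense finite set has a difference in `S`. -/
def IsIntersective (S : Set ℤ) : Prop :=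
  ∀ δ : ℝ, 0 < δ →
    ∃ M : ℕ, 0 < M ∧ ∀ E ⊆ range M, δ * M ≤ #E → ∃ x ∈ E, ∃ y ∈ E, (y : ℤ) - x ∈ S

theorem isIntersective_floor {a : ℕ → ℝ} (hs : ∀ k, EventuallySigned ((fwdDiff 1)^[k] a)) {k : ℕ}
    (hk : Tendsto (fun n : ℕ ↦ a n / (n : ℝ) ^ k) atTop (𝓝 0))
    (haway : ∀ (p : Polynomial ℤ) (c : ℝ),
      Tendsto (fun n : ℕ ↦ |a n - c * (p.eval (n : ℤ) : ℤ)|) atTop atTop) :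
    IsIntersective {s : ℤ | s ≠ 0 ∧ ∃ n : ℕ, 1 ≤ n ∧ s = ⌊a n⌋} := by
  intro δ hδ
  set S := {s : ℤ | s ≠ 0 ∧ ∃ n : ℕ, 1 ≤ n ∧ s = ⌊a n⌋} with hS
  -- Taking `p = 0` gives `|a n| → ∞`, so `⌊a n⌋ ≠ 0` from some `M` on; weights vanishing below `M`
  -- keep all frequencies in `S`.
  have h1 : Tendsto (fun n ↦ |a n|) atTop atTop := by simpa using haway 0 0
  obtain ⟨M, hM⟩ := eventually_atTop.1 ((h1.eventually_ge_atTop 1).and (eventually_ge_atTop 1))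
  have hMS : ∀ n, M ≤ n → ⌊a n⌋ ∈ S := by
    intro n hn
    refine ⟨fun h ↦ ?_, n, (hM n hn).2, rfl⟩
    rw [Int.floor_eq_zero_iff] at h
    have h2 := (hM n hn).1
    rw [abs_of_nonneg h.1] at h2
    exact absurd h.2 (not_lt.2 h2)
  obtain ⟨w, hw, hwM, hwa⟩ := exists_weight hs hk haway M
  set P : ℕ → C(UnitAddCircle, ℂ) := fun K ↦ ((∑ n ∈ range K, w n : ℝ) : ℂ)⁻¹ •
    ∑ n ∈ range K, ((w n : ℂ) * bump (a n)) • fourier ⌊a n⌋ with hP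
  have hPx : ∀ K x, P K x = wavg w (fun n ↦ bump (a n) * fourier ⌊a n⌋ x) K := by
    intro K x
    rw [hP, wavg]
    simp only [ContinuousMap.smul_apply, ContinuousMap.sum_apply, smul_eq_mul]
    rw [div_eq_inv_mul]
    simp only [mul_assoc]
  have hP0 : Tendsto (fun K ↦ P K 0) atTop (𝓝 (1 / 2)) := by
    refine (hw.tendsto_bump hwa).congr fun K ↦ ?_
    rw [hPx]
    simp only [fourier_eval_zero, mul_one]
  refine intersective_of_trigPolynomials (P := P) ?_ ?_ ?_ (one_div_ne_zero two_ne_zero) hP0 hδ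
  · intro K
    apply Submodule.smul_mem
    apply Submodule.sum_mem
    intro n _
    rcases lt_or_ge n M with h | h
    · have h0 : ((w n : ℂ) * bump (a n)) • (fourier ⌊a n⌋ : C(UnitAddCircle, ℂ)) = 0 :=
        ContinuousMap.ext fun x ↦ by
          rw [ContinuousMap.smul_apply, hwM n h]
          simp
      rw [h0]
      exact Submodule.zero_mem _
    · exact Submodule.smul_mem _ _ (Submodule.subset_span ⟨_, hMS n h, rfl⟩)
  · intro K x
    rw [hPx]
    apply hw.norm_wavg_le zero_le_one
    intro n
    rw [norm_mul]
    have : ‖fourier ⌊a n⌋ x‖ = 1 := Circle.norm_coe _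
    rw [this, mul_one]
    exact norm_bump_le _
  · intro x hx
    induction x using QuotientAddGroup.induction_on with
    | H θ =>
      refine (hw.tendsto_floor hwa (θ := θ) fun m hm ↦ hx ?_).congr fun K ↦ ?_
      · exact (AddCircle.coe_eq_zero_iff (1 : ℝ)).2 ⟨-m, by simp; linarith⟩
      · rw [hPx]
        congr 1
        funext n
        exact congrArg _ (fourier_eq_ex _ _).symm

/-- Otherwise, for almost every `x`, the visit times to `A` have no difference in `S`, so fewer than
`M * μ A / 2` of them lie below `M`. Integrating contradicts the invariance of `μ`, which gives the
mean `M * μ A`. -/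
theorem IsIntersective.isSetOfSingleRecurrence {S S' : Set ℤ} (hS : IsIntersective S)
    (hSS : ∀ s ∈ S, s ∈ S' ∧ s ≠ 0) : IsSetOfSingleRecurrence.{u} S' := by
  intro X _ μ _ T hT A hA hμA
  by_contra! H
  have hδ : 0 < (μ A).toReal / 2 :=
    half_pos (ENNReal.toReal_pos hμA.ne' (measure_ne_top μ A))
  obtain ⟨M, hM, hE⟩ := hS _ hδ
  set τ : Equiv.Perm X := T.toEquiv with hτ
  have hpow : ∀ i : ℕ, MeasurePreserving (⇑(τ ^ i)) μ μ := by
    intro i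
    rw [Equiv.Perm.coe_pow]
    exact hT.iterate i
  have hnull : ∀ i j : ℕ, (j : ℤ) - i ∈ S →
      μ (⇑(τ ^ i) ⁻¹' A ∩ ⇑(τ ^ j) ⁻¹' A) = 0 := by
    intro i j hij
    have h1 := nonpos_iff_eq_zero.1 (H _ (hSS _ hij).1 (hSS _ hij).2)
    have h2 : ⇑(τ ^ i) ⁻¹' (A ∩ ⇑(τ ^ ((j : ℤ) - i)) ⁻¹' A)
        = ⇑(τ ^ i) ⁻¹' A ∩ ⇑(τ ^ j) ⁻¹' A := by
      rw [Set.preimage_inter, ← Set.preimage_comp, ← Equiv.Perm.coe_mul, ← zpow_natCast τ i,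
        ← zpow_add, sub_add_cancel, zpow_natCast, zpow_natCast]
    rw [← h2]
    exact (hpow i).quasiMeasurePreserving.preimage_null h1
  have hae : ∀ᵐ x ∂μ, ∀ i j : ℕ, (j : ℤ) - i ∈ S →
      x ∉ ⇑(τ ^ i) ⁻¹' A ∩ ⇑(τ ^ j) ⁻¹' A := by
    rw [ae_all_iff]
    intro i
    rw [ae_all_iff]
    intro j
    by_cases hij : (j : ℤ) - i ∈ S
    · filter_upwards [measure_eq_zero_iff_ae_notMem.1 (hnull i j hij)] with x hx _
      exact hx
    · exact Eventually.of_forall fun x h ↦ absurd h hij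
  have hle : ∀ᵐ x ∂μ, ∑ i ∈ range M, Set.indicator (⇑(τ ^ i) ⁻¹' A) (fun _ ↦ (1 : ENNReal)) x
      ≤ ENNReal.ofReal ((μ A).toReal / 2 * M) := by
    filter_upwards [hae] with x hx
    classical
    have h1 : ∑ i ∈ range M, Set.indicator (⇑(τ ^ i) ⁻¹' A) (fun _ ↦ (1 : ENNReal)) x
        = #{i ∈ range M | x ∈ ⇑(τ ^ i) ⁻¹' A} := by
      simp only [Set.indicator_apply, sum_boole]
    rw [h1, ← ENNReal.ofReal_natCast]
    apply ENNReal.ofReal_le_ofReal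
    by_contra! hlt
    obtain ⟨i, hi, j, hj, hij⟩ := hE _ (filter_subset _ _) hlt.le
    exact hx i j hij ⟨(mem_filter.1 hi).2, (mem_filter.1 hj).2⟩
  have h2 := lintegral_mono_ae hle
  rw [lintegral_finsetSum] at h2
  · have h3 : ∀ i ∈ range M, ∫⁻ x, Set.indicator (⇑(τ ^ i) ⁻¹' A) (fun _ ↦ (1 : ENNReal)) x ∂μ
        = μ A := by
      intro i _
      rw [lintegral_indicator ((hpow i).measurable hA), setLIntegral_one,
        (hpow i).measure_preimage hA.nullMeasurableSet]
    rw [sum_congr rfl h3, sum_const, card_range, lintegral_const, measure_univ, mul_one,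
      nsmul_eq_mul, ENNReal.le_ofReal_iff_toReal_le (by finiteness) (by positivity),
      ENNReal.toReal_mul, ENNReal.toReal_natCast] at h2
    have hM' : (0 : ℝ) < M := by exact_mod_cast hM
    nlinarith
  · intro i _
    exact measurable_const.indicator ((hpow i).measurable hA)

theorem IsIntersective.exists_sub_mem {S : Set ℤ} (hS : IsIntersective S) {Λ : Set ℤ}
    (hΛ : 0 < upperDensity Λ) : ∃ x ∈ Λ, ∃ y ∈ Λ, y - x ∈ S := by
  classical
  by_contra! H
  -- The windows of length `M` covering `{-N, …, N}` may overshoot by a factor 2, so density `d / 4`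
  -- per window yields `d ≤ d / 2`.
  obtain ⟨M, hM, hE⟩ := hS (upperDensity Λ / 4) (by positivity)
  set d := upperDensity Λ with hd
  have hM' : (0 : ℝ) < M := by exact_mod_cast hM
  have hwin : ∀ t : ℤ, ∑ i ∈ range M, (if t + i ∈ Λ then (1 : ℝ) else 0) ≤ d / 4 * M := by
    intro t
    rw [sum_boole]
    by_contra! hlt
    obtain ⟨x, hx, y, hy, hxy⟩ := hE _ (filter_subset _ _) hlt.le
    apply H _ (mem_filter.1 hx).2 _ (mem_filter.1 hy).2
    rwa [add_sub_add_left_eq_sub]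
  have hwins : ∀ (L : ℕ) (t : ℤ),
      ∑ i ∈ range (M * L), (if t + i ∈ Λ then (1 : ℝ) else 0) ≤ d / 4 * M * L := by
    intro L t
    induction L with
    | zero => simp
    | succ L ih =>
      rw [mul_add, mul_one, sum_range_add]
      have := hwin (t + (M * L : ℕ))
      push_cast at this ⊢
      simp only [add_assoc] at this ⊢
      linarith
  have hcard : ∀ N : ℕ, ((Λ ∩ Set.Icc (-(N : ℤ)) (N : ℤ)).ncard : ℝ)
      = ∑ i ∈ range (2 * N + 1), (if -(N : ℤ) + i ∈ Λ then (1 : ℝ) else 0) := by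
    intro N
    rw [sum_boole, Nat.cast_inj]
    rw [← Set.ncard_coe_finset]
    symm
    apply Set.ncard_congr (fun (i : ℕ) _ ↦ -(N : ℤ) + i)
    · intro i hi
      rw [mem_coe, mem_filter, mem_range] at hi
      exact ⟨hi.2, by omega, by omega⟩
    · intro i j _ _ hij
      omega
    · rintro x ⟨hx, h1, h2⟩
      refine ⟨(x + N).toNat, ?_, by omega⟩
      rw [mem_coe, mem_filter, mem_range]
      refine ⟨by omega, ?_⟩
      rwa [show -(N : ℤ) + ((x + N).toNat : ℤ) = x by omega]
  have hev : ∀ᶠ N : ℕ in atTop,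
      ((Λ ∩ Set.Icc (-(N : ℤ)) (N : ℤ)).ncard : ℝ) / (2 * (N : ℝ) + 1) ≤ d / 2 := by
    filter_upwards [eventually_ge_atTop M] with N hN
    rw [div_le_iff₀ (by positivity), hcard]
    set L := (2 * N + 1) / M + 1 with hL
    have h1 : 2 * N + 1 ≤ M * L := (Nat.lt_mul_div_succ _ hM).le
    have h2 : M * L ≤ 2 * N + 1 + M := by
      rw [hL, mul_add, mul_one]
      gcongr
      exact Nat.mul_div_le _ _
    have h3 : (M : ℝ) * L ≤ 2 * (2 * N + 1) := by
      exact_mod_cast (show M * L ≤ 2 * (2 * N + 1) by omega)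
    calc _ ≤ ∑ i ∈ range (M * L), (if -(N : ℤ) + i ∈ Λ then (1 : ℝ) else 0) :=
          sum_le_sum_of_subset_of_nonneg (range_mono h1) fun i _ _ ↦ by split_ifs <;> norm_num
      _ ≤ d / 4 * M * L := hwins L _
      _ = d / 4 * (M * L) := by ring
      _ ≤ d / 4 * (2 * (2 * N + 1)) := by gcongr
      _ = _ := by ring
  have h5 : d ≤ d / 2 := by
    rw [hd, upperDensity]
    exact limsup_le_of_le (isCoboundedUnder_le_of_le atTop (x := 0) fun N ↦ by positivity) hev
  linarith

end Recurrence

end HardyRecurrence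

theorem theoremC (a : ℝ → ℝ)
    (ha : HardyRecurrence.MemHardy a)
    (hgrowth : HardyRecurrence.PolynomialGrowth a)
    (haway : ∀ (p : Polynomial ℤ) (c : ℝ),
      Tendsto (fun x : ℝ => |a x - c * Polynomial.aeval x p|) atTop atTop) :
    HardyRecurrence.IsSetOfSingleRecurrence.{u} {s : ℤ | ∃ n : ℕ, 1 ≤ n ∧ s = ⌊a (n : ℝ)⌋} ∧
    ∀ Λ : Set ℤ, 0 < HardyRecurrence.upperDensity Λ →
      ∃ x ∈ Λ, ∃ y ∈ Λ, ∃ n : ℕ, 1 ≤ n ∧ y - x = ⌊a (n : ℝ)⌋ ∧ ⌊a (n : ℝ)⌋ ≠ 0 := by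
  obtain ⟨k, hk⟩ := hgrowth
  have hS := HardyRecurrence.isIntersective_floor (a := fun n : ℕ ↦ a n) (k := k)
    ha.eventuallySigned (hk.comp tendsto_natCast_atTop_atTop) (fun p c ↦ by
      refine ((haway p c).comp tendsto_natCast_atTop_atTop).congr fun n ↦ ?_
      have h : Polynomial.aeval (n : ℝ) p = ((p.eval (n : ℤ) : ℤ) : ℝ) := by
        have := Polynomial.aeval_algebraMap_apply_eq_algebraMap_eval (A := ℝ) (n : ℤ) p
        simpa using this
      simp only [Function.comp, h])
  refine ⟨hS.isSetOfSingleRecurrence fun s hs ↦ ⟨hs.2, hs.1⟩, fun Λ hΛ ↦ ?_⟩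
  obtain ⟨x, hx, y, hy, hne, n, hn, hxy⟩ := hS.exists_sub_mem hΛ
  exact ⟨x, hx, y, hy, n, hn, hxy, hxy ▸ hne⟩
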